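/- Let $\mathbb H$ be the upper half plane. For $z=(z_1,z_2)\in\mathbb H^2$ put $y_j=\operatorname{Im} z_j$, $t=\sqrt{y_1y_2}$ and $s=\sqrt{y_1/y_2}$. For $v>0$ and $b,c\in\mathbb Z$ put $$B(v,s;b,c)=\int_1^\infty e^{-\pi v(b/s+cs)^2r}\,r^{-3/2}\,dr,\qquad I(v,s;b,c)=\begin{cases}4\pi\sqrt v\,\min(|b/s|,|cs|)&\text{if }-bc>0,\\ 0&\text{if }-bc\le 0,\end{cases}$$ and for $m\in\mathbb Z$ $$\check\Xi(v,z,m)=\frac12\sum_{\substack{b,c\in\mathbb Z\\ -bc=m}}\frac{t}{\sqrt v}\,\bigl(B(v,s;b,c)-I(v,s;b,c)\bigr).$$ Then for every $z\in\mathbb H^2$ and every $\tau=u+iv\in\mathbb H$ the sums defining $\check\Xi(v,z,m)$ $(m\in\mathbb Z)$ and, with $q=e^{2\pi i\tau}$, the series $\sum_{m\in\mathbb Z}\check\Xi(v,z,m)q^m$ converge absolutely, and for every fixed $z\in\mathbb H^2$ $$\check\Xi^+(\tau,z)=\sum_{m\in\mathbb Z}\check\Xi(v,z,m)\,q^m-\frac{1}{2v}\,t\left(s+\frac1s\right)$$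 is, as a function of $\tau$, a non-holomorphic modular form of weight $2$ for $SL_2(\mathbb Z)$. That is: it is a $C^\infty$ function of $\tau\in\mathbb H$ (in the real sense) which is not holomorphic; it satisfies $$\check\Xi^+\!\left(\frac{a\tau+b}{c\tau+d},z\right)=(c\tau+d)^2\,\check\Xi^+(\tau,z)\qquad\text{for all }\begin{pmatrix}a&b\\c&d\end{pmatrix}\in SL_2(\mathbb Z);$$ and it has at most polynomial growth at the cusp: there is $N\ge 0$ such that $\check\Xi^+(u+iv,z)=O(v^N)$ as $v\to\infty$, uniformly in $u$. -/

import Mathlib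

open UpperHalfPlane MeasureTheory
open scoped MatrixGroups ModularForm ContDiff

noncomputable section

/-- The coordinate `t = √(y₁ y₂)` of `z = (z₁, z₂) ∈ ℍ²`, where `yⱼ = Im zⱼ`. -/
def tCoord (z : ℍ × ℍ) : ℝ := Real.sqrt (z.1.im * z.2.im)

/-- The coordinate `s = √(y₁ / y₂)` of `z = (z₁, z₂) ∈ ℍ²`, where `yⱼ = Im zⱼ`. -/
def sCoord (z : ℍ × ℍ) : ℝ := Real.sqrt (z.1.im / z.2.im)

/-- `B(v, s; b, c) = ∫_1^∞ exp(-π v (b/s + c s)² r) r^(-3/2) dr`. -/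
def boundaryB (v s : ℝ) (b c : ℤ) : ℝ :=
  ∫ r in Set.Ioi (1 : ℝ),
    Real.exp (-Real.pi * v * ((b : ℝ) / s + (c : ℝ) * s) ^ 2 * r) * r ^ (-(3 / 2) : ℝ)

/-- `I(v, s; b, c) = 4 π √v min(|b/s|, |c s|)` if `-bc > 0`, and `0` otherwise. -/
def boundaryI (v s : ℝ) (b c : ℤ) : ℝ :=
  if 0 < -(b * c) then
    4 * Real.pi * Real.sqrt v * min |(b : ℝ) / s| |(c : ℝ) * s|
  else 0

/-- `ξ̌(v, z; b, c) = (t / √v) (B(v, s; b, c) - I(v, s; b, c))`. -/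
def boundaryXi (v : ℝ) (z : ℍ × ℍ) (b c : ℤ) : ℝ :=
  tCoord z / Real.sqrt v * (boundaryB v (sCoord z) b c - boundaryI v (sCoord z) b c)

/-- The pairs of integers `(b, c)` with `-bc = m`; an infinite set exactly when `m = 0`. -/
def pairsOf (m : ℤ) : Set (ℤ × ℤ) := {p | -(p.1 * p.2) = m}

/-- The boundary function `Ξ̌(v, z, m) = (1/2) ∑_{-bc = m} ξ̌(v, z; b, c)`. -/
def boundaryFun (v : ℝ) (z : ℍ × ℍ) (m : ℤ) : ℝ :=
  1 / 2 * ∑' p : pairsOf m, boundaryXi v z p.1.1 p.1.2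

/-- `q = exp(2 π i τ)`. -/
def nome (τ : ℍ) : ℂ := Complex.exp (2 * Real.pi * Complex.I * (τ : ℂ))

/-- The corrected generating series
`Ξ̌⁺(τ, z) = ∑_{m ∈ ℤ} Ξ̌(v, z, m) q^m - (1 / (2 v)) t (s + 1 / s)`, where `v = Im τ`. -/
def boundarySeriesPlus (z : ℍ × ℍ) (τ : ℍ) : ℂ :=
  (∑' m : ℤ, (boundaryFun τ.im z m : ℂ) * nome τ ^ m)
    - ((1 / (2 * τ.im) * tCoord z * (sCoord z + 1 / sCoord z) : ℝ) : ℂ)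

/-- `f : ℍ → ℂ` is a (not necessarily holomorphic) modular form of weight `k` for `SL₂(ℤ)`:
it is smooth in the real sense, `f ((aτ + b) / (cτ + d)) = (cτ + d)^k f τ` for all
`(a b; c d) ∈ SL₂(ℤ)`, and it has at most polynomial growth in `Im τ` at the cusp,
uniformly in `Re τ`. -/
structure IsSmoothModularForm (k : ℤ) (f : ℍ → ℂ) : Prop where
  smooth : ContDiffOn ℝ ∞ (f ∘ UpperHalfPlane.ofComplex) {w : ℂ | 0 < w.im}
  slash_eq : ∀ γ : SL(2, ℤ), f ∣[k] γ = f
  moderate_growth : ∃ N : ℕ, f =O[UpperHalfPlane.atImInfty] fun τ : ℍ => τ.im ^ N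

end

/-!
Write `s = exp w`, `x = b / s`, `y = c s` and `m = -bc = -xy`. Integration by parts expresses the
integral `B` through `η(X) = exp(-π X²) + 2π X ∫_0^X exp(-π ξ²) dξ`, a smooth version of `π |X|`,
and the term `I` accounts for the difference of `|x + y|` and `|x| + |y|`
(`integral_exp_mul_rpow`, `boundaryXi_eq`). Hence the generating series is `t` times
`bdrySeries w τ`, the sum over `(b, c) ∈ ℤ²` of
`(η(√v (x + y)) / √v - π |x| - π |y|) q^(-bc)`, minus `(s + 1/s) / (2v)`. Its terms decay
exponentially in `(b, c)`: for `bc ≥ 0` they are bounded by a definite Gaussian, and for `bc < 0`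
the factor `q^(-bc)` decays. This gives convergence, and boundedness as `v → ∞`.

Modularity is not visible in `τ` but follows from a differential equation in `w`. The operator
`∂_w² - 1` annihilates the correction term and turns `bdrySeries` into the theta series
`thetaKernel` of the quadratic form `-bc` with a quadratic polynomial factor
(`hasDerivAt_bdrySeriesFlow`). Poisson summation in `b` rewrites `thetaKernel` as a sum over pairs
`(c, n)` of `(c τ̄ + n)²` times a function of `|cτ + n|² / v`, which shows that it has weight two
(`thetaKernel_eq_tsum_dualTerm`, `thetaKernel_smul`). So for `γ ∈ SL₂(ℤ)` with
automorphy factor `j`, the difference of `bdrySeries w (γτ)` and `j² bdrySeries w τ` solves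
`u'' = u` in `w`. It is bounded in `w` (`exists_norm_bdrySeries_le`): the terms with `bc ≠ 0` are
bounded independently of `w`, and the sums over the two axes are Riemann sums whose main terms
`s / (2v)` and `1 / (2vs)` are cancelled by the correction (`abs_tsum_int_softAbs_sub_le`). Bounded
solutions of `u'' = u` on the real line vanish.

For smoothness, the first derivatives in `τ` and `v` of such a series are again series of the same
kind, with weights of polynomial growth in `(b, c)`, or series with Gaussian coefficients
(`hasFDerivAt_latSeries_bdryTerm`, `hasFDerivAt_latSeries_latGauss`), so that induction on the
order of differentiability applies. Holomorphy would force the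
coefficient of `dv` to vanish, that is `√v Θ = s + 1/s` for a theta function `Θ` which is at least
`1` on the imaginary axis; this fails for large `v`.
-/

open Filter Topology
open scoped FourierTransform

/-! ### A smoothing of the absolute value -/

/-- The odd Gaussian primitive `κ(y) = 2π ∫_0^y exp(-π ξ²) dξ`, a smooth version of
`π * sign y`. -/
noncomputable def gaussPrim (y : ℝ) : ℝ :=
  2 * Real.pi * ∫ ξ in (0 : ℝ)..y, Real.exp (-Real.pi * ξ ^ 2)

/-- The function `η(y) = exp(-π y²) + y κ(y)`, a smooth version of `π |y|`; it is the even
primitive of `κ`. -/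
noncomputable def softAbs (y : ℝ) : ℝ := Real.exp (-Real.pi * y ^ 2) + y * gaussPrim y

lemma hasDerivAt_gaussPrim (y : ℝ) :
    HasDerivAt gaussPrim (2 * Real.pi * Real.exp (-Real.pi * y ^ 2)) y := by
  have hc : Continuous fun ξ : ℝ => Real.exp (-Real.pi * ξ ^ 2) := by fun_prop
  exact (intervalIntegral.integral_hasDerivAt_right (hc.intervalIntegrable _ _)
    (hc.stronglyMeasurableAtFilter _ _) hc.continuousAt).const_mul _

lemma hasDerivAt_gaussExp (y : ℝ) :
    HasDerivAt (fun y : ℝ => Real.exp (-Real.pi * y ^ 2))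
      (-(2 * Real.pi * y) * Real.exp (-Real.pi * y ^ 2)) y := by
  have := ((hasDerivAt_pow 2 y).const_mul (-Real.pi)).exp
  convert! this using 1
  push_cast
  ring

lemma hasDerivAt_softAbs (y : ℝ) : HasDerivAt softAbs (gaussPrim y) y := by
  have := (hasDerivAt_gaussExp y).add ((hasDerivAt_id y).mul (hasDerivAt_gaussPrim y))
  convert! this using 1
  simp only [id]
  ring

lemma gaussPrim_zero : gaussPrim 0 = 0 := by simp [gaussPrim]

lemma gaussPrim_neg (y : ℝ) : gaussPrim (-y) = -gaussPrim y := by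
  have h := intervalIntegral.integral_comp_neg (a := 0) (b := y)
    (fun ξ : ℝ => Real.exp (-Real.pi * ξ ^ 2))
  simp only [neg_sq, neg_zero] at h
  rw [gaussPrim, gaussPrim, h, intervalIntegral.integral_symm]
  ring

lemma softAbs_neg (y : ℝ) : softAbs (-y) = softAbs y := by
  simp [softAbs, gaussPrim_neg]

lemma tendsto_gaussPrim : Tendsto gaussPrim atTop (𝓝 Real.pi) := by
  have hi := (integrable_exp_neg_mul_sq Real.pi_pos).integrableOn (s := Set.Ioi (0 : ℝ))
  have h := (intervalIntegral_tendsto_integral_Ioi 0 hi tendsto_id).const_mul (2 * Real.pi)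
  rw [integral_gaussian_Ioi, div_self Real.pi_ne_zero, Real.sqrt_one] at h
  convert! h using 2
  ring

lemma monotone_gaussPrim : Monotone gaussPrim :=
  monotone_of_hasDerivAt_nonneg hasDerivAt_gaussPrim fun y => by
    simp only [Pi.zero_apply]; positivity

lemma gaussPrim_le (y : ℝ) : gaussPrim y ≤ Real.pi :=
  monotone_gaussPrim.ge_of_tendsto tendsto_gaussPrim y

lemma abs_gaussPrim_le (y : ℝ) : |gaussPrim y| ≤ Real.pi := by
  rw [abs_le]
  have := gaussPrim_le (-y)
  rw [gaussPrim_neg] at this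
  exact ⟨by linarith, gaussPrim_le y⟩

/-- Integration by parts: the integral defining `B` measures how far `η` is from `π |y|`. -/
lemma integral_exp_mul_rpow (y : ℝ) :
    ∫ r in Set.Ioi (1 : ℝ), Real.exp (-Real.pi * y ^ 2 * r) * r ^ (-(3 / 2) : ℝ)
      = 2 * (softAbs y - Real.pi * |y|) := by
  wlog hy : 0 ≤ y generalizing y
  · have := this (-y) (by linarith)
    rwa [neg_sq, softAbs_neg, abs_neg] at this
  have hs (r : ℝ) (hr : 0 < r) : r ^ (-(3 / 2) : ℝ) = (r * √r)⁻¹ := by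
    rw [Real.rpow_neg hr.le, show (3 / 2 : ℝ) = 1 + 1 / 2 by norm_num, Real.rpow_add hr,
      Real.rpow_one, Real.sqrt_eq_rpow]
  have hexp (r : ℝ) (hr : 0 < r) : -Real.pi * (y * √r) ^ 2 = -Real.pi * y ^ 2 * r := by
    rw [mul_pow, Real.sq_sqrt hr.le]; ring
  -- a primitive of the integrand
  let P : ℝ → ℝ := fun r => -2 * ((√r)⁻¹ * Real.exp (-Real.pi * (y * √r) ^ 2))
    - 2 * y * gaussPrim (y * √r)
  have hP : ∀ r ∈ Set.Ici (1 : ℝ),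
      HasDerivAt P (Real.exp (-Real.pi * y ^ 2 * r) * r ^ (-(3 / 2) : ℝ)) r := by
    intro r hr
    have hr0 : 0 < r := lt_of_lt_of_le one_pos hr
    have hq : 0 < √r := Real.sqrt_pos.2 hr0
    have h1 := Real.hasDerivAt_sqrt hr0.ne'
    have h2 := h1.const_mul y
    have := (((h1.inv hq.ne').mul ((hasDerivAt_gaussExp (y * √r)).comp r h2)).const_mul (-2)).sub
      (((hasDerivAt_gaussPrim (y * √r)).comp r h2).const_mul (2 * y))
    convert! this using 1
    rw [hs r hr0, ← hexp r hr0]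
    have hrr : r = √r ^ 2 := (Real.sq_sqrt hr0.le).symm
    simp only [Function.comp, Pi.inv_apply]
    generalize Real.exp (-Real.pi * (y * √r) ^ 2) = E
    rw [show (r * √r) = √r ^ 3 by nth_rewrite 1 [hrr]; ring]
    field_simp
    ring
  have hlim : Tendsto P atTop (𝓝 (-(2 * Real.pi * |y|))) := by
    have h1 : Tendsto (fun r : ℝ => (√r)⁻¹ * Real.exp (-Real.pi * (y * √r) ^ 2)) atTop (𝓝 0) := by
      refine squeeze_zero (fun r => by positivity) (fun r => ?_)
        (tendsto_inv_atTop_zero.comp Real.tendsto_sqrt_atTop)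
      refine mul_le_of_le_one_right (by positivity) (Real.exp_le_one_iff.2 ?_)
      have := Real.pi_pos
      nlinarith [mul_nonneg this.le (sq_nonneg (y * √r))]
    have h2 : Tendsto (fun r : ℝ => 2 * y * gaussPrim (y * √r)) atTop (𝓝 (2 * Real.pi * |y|)) := by
      rcases hy.eq_or_lt with rfl | hy
      · simp
      · have := (tendsto_gaussPrim.comp (Real.tendsto_sqrt_atTop.const_mul_atTop hy)).const_mul
          (2 * y)
        rw [abs_of_pos hy]
        convert! this using 2
        ring
    convert! (h1.const_mul (-2)).sub h2 using 2
    ring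
  rw [integral_Ioi_of_hasDerivAt_of_nonneg' hP (fun r hr => ?_) hlim]
  · simp only [P, Real.sqrt_one, softAbs]
    ring_nf
  · have : (0 : ℝ) < r := one_pos.trans hr
    positivity

lemma softAbs_sub_nonneg (y : ℝ) : 0 ≤ softAbs y - Real.pi * |y| := by
  have h : 0 ≤ ∫ r in Set.Ioi (1 : ℝ), Real.exp (-Real.pi * y ^ 2 * r) * r ^ (-(3 / 2) : ℝ) :=
    setIntegral_nonneg measurableSet_Ioi fun r hr => by
      have : (0 : ℝ) < r := one_pos.trans hr
      positivity
  rw [integral_exp_mul_rpow] at h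
  linarith

lemma softAbs_sub_le (y : ℝ) : softAbs y - Real.pi * |y| ≤ Real.exp (-Real.pi * y ^ 2) := by
  have h : y * gaussPrim y ≤ |y| * Real.pi := (le_abs_self _).trans <| by
    rw [abs_mul]; gcongr; exact abs_gaussPrim_le y
  rw [softAbs]
  linarith

/-- The quantitative form of `κ(y) → π sign y`. -/
lemma abs_gaussPrim_mul_sub_le (y : ℝ) :
    |y * gaussPrim y - Real.pi * (|y|)| ≤ Real.exp (-Real.pi * y ^ 2) := by
  have h := softAbs_sub_nonneg y
  have h2 : y * gaussPrim y ≤ |y| * Real.pi := (le_abs_self _).trans <| by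
    rw [abs_mul]; gcongr; exact abs_gaussPrim_le y
  rw [softAbs] at h
  rw [abs_le]
  constructor
  · linarith
  · have := Real.exp_pos (-Real.pi * y ^ 2)
    linarith

/-! ### Riemann sums of the smoothing error -/

lemma softAbs_zero : softAbs 0 = 1 := by simp [softAbs]

/-- A primitive on `[0, ∞)` of `y ↦ η(y) - π y`. -/
noncomputable def softAbsPrim (y : ℝ) : ℝ :=
  y / 2 * (y * gaussPrim y - Real.pi * y) + y / 2 * Real.exp (-Real.pi * y ^ 2)
    + gaussPrim y / (4 * Real.pi)

lemma hasDerivAt_softAbsPrim (y : ℝ) :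
    HasDerivAt softAbsPrim (softAbs y - Real.pi * y) y := by
  have h0 := hasDerivAt_id y
  have := (((h0.div_const 2).mul ((h0.mul (hasDerivAt_gaussPrim y)).sub
    (h0.const_mul Real.pi))).add ((h0.div_const 2).mul (hasDerivAt_gaussExp y))).add
    ((hasDerivAt_gaussPrim y).div_const (4 * Real.pi))
  convert! this using 1
  have := Real.pi_ne_zero
  simp only [id, softAbs, Pi.mul_apply, Pi.sub_apply]
  field_simp
  ring

lemma tendsto_softAbsPrim : Tendsto softAbsPrim atTop (𝓝 (1 / 4)) := by
  have hg : Tendsto (fun y : ℝ => y * Real.exp (-Real.pi * y ^ 2)) atTop (𝓝 0) := by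
    have h := rpow_mul_exp_neg_mul_sq_isLittleO_exp_neg Real.pi_pos 1
    have h2 := (h.isBigO.trans_tendsto
      (Real.tendsto_exp_atBot.comp
        (tendsto_id.const_mul_atTop_of_neg (by norm_num : -(1 / 2 : ℝ) < 0))))
    simpa using h2
  have h1 : Tendsto (fun y : ℝ => y / 2 * (y * gaussPrim y - Real.pi * y)) atTop (𝓝 0) := by
    refine squeeze_zero_norm' ?_ hg
    filter_upwards [eventually_ge_atTop 0] with y hy
    have := abs_gaussPrim_mul_sub_le y
    rw [abs_of_nonneg hy] at this
    rw [Real.norm_eq_abs, abs_mul, abs_of_nonneg (by positivity)]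
    have h3 : y / 2 ≤ y := by linarith
    gcongr
  have h2 : Tendsto (fun y : ℝ => y / 2 * Real.exp (-Real.pi * y ^ 2)) atTop (𝓝 0) := by
    have := hg.const_mul (1 / 2)
    rw [mul_zero] at this
    exact this.congr fun y => by ring
  have h3 := tendsto_gaussPrim.div_const (4 * Real.pi)
  have := (h1.add h2).add h3
  convert! this using 2
  have := Real.pi_ne_zero
  field_simp
  norm_num

lemma antitone_softAbs_sub : Antitone fun y => softAbs y - Real.pi * y :=
  antitone_of_hasDerivAt_nonpos
    (fun y => (hasDerivAt_softAbs y).sub ((hasDerivAt_id y).const_mul Real.pi)) fun y => by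
      simpa using gaussPrim_le y

lemma summable_softAbs_sub {a : ℝ} (ha : 0 < a) :
    Summable fun n : ℕ => softAbs (n * a) - Real.pi * (n * a) := by
  have h0 : Summable fun n : ℕ => Real.exp (-(Real.pi * a ^ 2) * n) := by
    have := Real.summable_pow_mul_exp_neg_nat_mul 0 (r := Real.pi * a ^ 2)
      (by have := Real.pi_pos; positivity)
    simpa using this
  refine Summable.of_nonneg_of_le (fun n => ?_) (fun n => ?_) h0
  · have := softAbs_sub_nonneg (n * a)
    rwa [abs_of_nonneg (by positivity)] at this
  · have := softAbs_sub_le (n * a)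
    rw [abs_of_nonneg (by positivity)] at this
    refine this.trans (Real.exp_le_exp.2 ?_)
    have h : (n : ℝ) ≤ n ^ 2 := by exact_mod_cast Nat.le_self_pow two_ne_zero n
    have hp : 0 < Real.pi * a ^ 2 := by have := Real.pi_pos; positivity
    nlinarith

/-- Comparison of the sum over `n ≥ 1` with the integral over `[0, ∞)`. -/
lemma abs_tsum_nat_softAbs_sub_le {a : ℝ} (ha : 0 < a) :
    |∑' n : ℕ, (softAbs ((n + 1 : ℕ) * a) - Real.pi * ((n + 1 : ℕ) * a)) - 1 / (4 * a)| ≤ 1 := by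
  set g : ℕ → ℝ := fun n => softAbs (n * a) - Real.pi * (n * a) with hg
  have hsum : Summable g := summable_softAbs_sub ha
  have hsum1 : Summable fun n => g (n + 1) := (summable_nat_add_iff 1).2 hsum
  have hstep (n : ℕ) : a * g (n + 1) ≤ softAbsPrim ((n + 1 : ℕ) * a) - softAbsPrim (n * a) ∧
      softAbsPrim ((n + 1 : ℕ) * a) - softAbsPrim (n * a) ≤ a * g n := by
    have hlt : (n : ℝ) * a < (n + 1 : ℕ) * a := by push_cast; linarith
    obtain ⟨y, hy, he⟩ := exists_hasDerivAt_eq_slope softAbsPrim _ hlt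
      (fun x _ => (hasDerivAt_softAbsPrim x).continuousAt.continuousWithinAt)
      (fun x _ => hasDerivAt_softAbsPrim x)
    rw [eq_div_iff (by linarith)] at he
    have hd : ((n + 1 : ℕ) : ℝ) * a - n * a = a := by push_cast; ring
    rw [← he, hd, mul_comm a, mul_comm a]
    exact ⟨mul_le_mul_of_nonneg_right (antitone_softAbs_sub hy.2.le) ha.le,
      mul_le_mul_of_nonneg_right (antitone_softAbs_sub hy.1.le) ha.le⟩
  have hgn (n : ℕ) : 0 ≤ g n := by
    have := softAbs_sub_nonneg (n * a)
    rwa [abs_of_nonneg (by positivity)] at this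
  have htel : HasSum (fun n : ℕ => softAbsPrim ((n + 1 : ℕ) * a) - softAbsPrim (n * a))
      (1 / 4) := by
    rw [hasSum_iff_tendsto_nat_of_nonneg
      fun n => (mul_nonneg ha.le (hgn (n + 1))).trans (hstep n).1]
    have h0 : softAbsPrim ((0 : ℕ) * a) = 0 := by simp [softAbsPrim, gaussPrim_zero]
    simp only [Finset.sum_range_sub (fun n : ℕ => softAbsPrim (n * a)), h0, sub_zero]
    exact tendsto_softAbsPrim.comp (tendsto_natCast_atTop_atTop.atTop_mul_const ha)
  have h1 := hasSum_le (fun n => (hstep n).1) (hsum1.hasSum.mul_left a) htel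
  have h2 := hasSum_le (fun n => (hstep n).2) htel (hsum.hasSum.mul_left a)
  have h3 := hsum.tsum_eq_zero_add
  have h4 : g 0 = 1 := by simp [hg, softAbs_zero]
  have ha4 : a * (1 / (4 * a)) = 1 / 4 := by field_simp
  rw [abs_le]
  constructor
  · refine le_of_mul_le_mul_left ?_ ha
    nlinarith
  · refine le_of_mul_le_mul_left ?_ ha
    nlinarith

lemma summable_int_softAbs_sub {a : ℝ} (ha : 0 < a) :
    Summable fun n : ℤ => softAbs (n * a) - Real.pi * |n * a| := by
  refine Summable.of_nat_of_neg ?_ ?_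
  · refine (summable_softAbs_sub ha).congr fun n => ?_
    simp [abs_of_pos ha, abs_mul]
  · refine (summable_softAbs_sub ha).congr fun n => ?_
    simp [abs_of_pos ha, abs_mul, softAbs_neg]

/-- The sum of `η - π|·|` over the lattice `a ℤ` is `1 / (2 a)` up to a bounded error. -/
lemma abs_tsum_int_softAbs_sub_le {a : ℝ} (ha : 0 < a) :
    |∑' n : ℤ, (softAbs (n * a) - Real.pi * |n * a|) - 1 / (2 * a)| ≤ 3 := by
  have hsum := (summable_nat_add_iff 1).2 (summable_softAbs_sub ha)
  have hneg (n : ℕ) : softAbs ((-(n + 1 : ℕ) : ℤ) * a) - Real.pi * |(-(n + 1 : ℕ) : ℤ) * a|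
      = softAbs ((n + 1 : ℕ) * a) - Real.pi * ((n + 1 : ℕ) * a) := by
    rw [show (((-(n + 1 : ℕ) : ℤ) : ℝ)) * a = -(((n + 1 : ℕ) : ℝ) * a) by push_cast; ring,
      softAbs_neg, abs_neg, abs_of_nonneg (by positivity)]
  have hpos (n : ℕ) : softAbs ((n : ℤ) * a) - Real.pi * |(n : ℤ) * a|
      = softAbs (n * a) - Real.pi * (n * a) := by
    rw [Int.cast_natCast, abs_of_nonneg (by positivity)]
  have h := tsum_of_nat_of_neg_add_one
    (f := fun n : ℤ => softAbs (n * a) - Real.pi * |n * a|)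
    ((summable_softAbs_sub ha).congr fun n => (hpos n).symm)
    (hsum.congr fun n => by rw [← hneg]; push_cast; rfl)
  have e1 : ∑' n : ℕ, (softAbs ((n : ℤ) * a) - Real.pi * |(n : ℤ) * a|)
      = 1 + ∑' n : ℕ, (softAbs ((n + 1 : ℕ) * a) - Real.pi * ((n + 1 : ℕ) * a)) := by
    rw [tsum_congr hpos, (summable_softAbs_sub ha).tsum_eq_zero_add]
    simp [softAbs_zero]
  have e2 : ∑' n : ℕ, (softAbs ((-((n : ℤ) + 1) : ℤ) * a) - Real.pi * |(-((n : ℤ) + 1) : ℤ) * a|)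
      = ∑' n : ℕ, (softAbs ((n + 1 : ℕ) * a) - Real.pi * ((n + 1 : ℕ) * a)) :=
    tsum_congr fun n => by rw [← hneg]; push_cast; rfl
  rw [h, e1, e2]
  have hb := abs_le.1 (abs_tsum_nat_softAbs_sub_le ha)
  have h12 : 1 / (2 * a) = 2 * (1 / (4 * a)) := by field_simp; norm_num
  rw [h12, abs_le]
  constructor <;> linarith [hb.1, hb.2]

/-! ### Decay of the terms over the lattice -/

/-- The `ℓ¹`-size `|b| + |c|` of a lattice vector `(b, c)`. -/
def latSize (p : ℤ × ℤ) : ℝ := |(p.1 : ℝ)| + |(p.2 : ℝ)|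

lemma latSize_nonneg (p : ℤ × ℤ) : 0 ≤ latSize p := by unfold latSize; positivity

lemma summable_int_pow_mul_exp (k : ℕ) {β : ℝ} (hβ : 0 < β) :
    Summable fun n : ℤ => (1 + |(n : ℝ)|) ^ k * Real.exp (-β * |(n : ℝ)|) := by
  have h : Summable fun n : ℕ => (1 + (n : ℝ)) ^ k * Real.exp (-β * n) := by
    have h1 := ((summable_nat_add_iff 1).2
      (Real.summable_pow_mul_exp_neg_nat_mul k hβ)).mul_left (Real.exp β)
    refine h1.congr fun n => ?_
    rw [mul_left_comm, ← Real.exp_add]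
    push_cast
    rw [add_comm (n : ℝ) 1]
    congr 2
    ring
  refine Summable.of_nat_of_neg ?_ ?_ <;> simpa using h

lemma summable_majorant (k : ℕ) {β : ℝ} (hβ : 0 < β) :
    Summable fun p : ℤ × ℤ => (1 + latSize p) ^ k * Real.exp (-β * latSize p) := by
  have h := (summable_int_pow_mul_exp k hβ).mul_of_nonneg (summable_int_pow_mul_exp k hβ)
    (fun n => by positivity) (fun n => by positivity)
  refine Summable.of_nonneg_of_le (fun p => ?_) (fun p => ?_) h
  · have := latSize_nonneg p; positivity
  · have e : Real.exp (-β * latSize p) =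
        Real.exp (-β * |(p.1 : ℝ)|) * Real.exp (-β * |(p.2 : ℝ)|) := by
      rw [← Real.exp_add, latSize]; ring_nf
    rw [e, mul_mul_mul_comm, ← mul_pow]
    have h1 : 1 + latSize p ≤ (1 + |(p.1 : ℝ)|) * (1 + |(p.2 : ℝ)|) := by
      rw [latSize]; nlinarith [abs_nonneg (p.1 : ℝ), abs_nonneg (p.2 : ℝ)]
    have := latSize_nonneg p
    gcongr

/-- The first coordinate `x = b / s` of `(b, c)`, where `s = exp w`. -/
noncomputable def latX (w : ℝ) (p : ℤ × ℤ) : ℝ := p.1 * Real.exp (-w)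

/-- The second coordinate `y = c s` of `(b, c)`, where `s = exp w`. -/
noncomputable def latY (w : ℝ) (p : ℤ × ℤ) : ℝ := p.2 * Real.exp w

lemma latX_mul_latY (w : ℝ) (p : ℤ × ℤ) : latX w p * latY w p = p.1 * p.2 := by
  have : Real.exp (-w) * Real.exp w = 1 := by rw [← Real.exp_add]; simp
  rw [latX, latY, mul_mul_mul_comm, this, mul_one]

lemma abs_latX_le {w W : ℝ} (hw : |w| ≤ W) (p : ℤ × ℤ) :
    |latX w p| ≤ Real.exp W * |(p.1 : ℝ)| := by
  rw [latX, abs_mul, Real.abs_exp, mul_comm]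
  gcongr
  exact (neg_le_abs w).trans hw

lemma abs_latY_le {w W : ℝ} (hw : |w| ≤ W) (p : ℤ × ℤ) :
    |latY w p| ≤ Real.exp W * |(p.2 : ℝ)| := by
  rw [latY, abs_mul, Real.abs_exp, mul_comm]
  gcongr
  exact (le_abs_self w).trans hw

lemma abs_latX_add_abs_latY_le {w W : ℝ} (hw : |w| ≤ W) (p : ℤ × ℤ) :
    |latX w p| + |latY w p| ≤ Real.exp W * latSize p := by
  rw [latSize, mul_add]
  exact add_le_add (abs_latX_le hw p) (abs_latY_le hw p)

lemma abs_int_le_sq (n : ℤ) : |(n : ℝ)| ≤ (n : ℝ) ^ 2 := by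
  have : |n| ≤ n ^ 2 := by
    rw [← sq_abs]
    rcases eq_or_ne n 0 with rfl | h
    · simp
    · nlinarith [Int.one_le_abs h]
  exact_mod_cast this

lemma latSize_le_sq_add_sq {w W : ℝ} (hw : |w| ≤ W) (p : ℤ × ℤ) :
    Real.exp (-2 * W) * latSize p ≤ latX w p ^ 2 + latY w p ^ 2 := by
  have h1 : Real.exp (-2 * W) ≤ Real.exp (-w) ^ 2 := by
    rw [← Real.exp_nat_mul]
    exact Real.exp_le_exp.2 (by push_cast; linarith [(le_abs_self w).trans hw])
  have h2 : Real.exp (-2 * W) ≤ Real.exp w ^ 2 := by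
    rw [← Real.exp_nat_mul]
    exact Real.exp_le_exp.2 (by push_cast; linarith [(neg_le_abs w).trans hw])
  have := abs_int_le_sq p.1
  have := abs_int_le_sq p.2
  rw [latSize, mul_add, latX, latY, mul_pow, mul_pow, mul_comm ((p.1 : ℝ) ^ 2),
    mul_comm ((p.2 : ℝ) ^ 2)]
  gcongr

lemma latSize_le_two_mul_abs {p : ℤ × ℤ} (hp : p.1 * p.2 ≠ 0) :
    latSize p ≤ 2 * |(p.1 : ℝ) * p.2| := by
  have h1 : (1 : ℝ) ≤ |(p.1 : ℝ)| := by
    exact_mod_cast Int.one_le_abs (left_ne_zero_of_mul hp)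
  have h2 : (1 : ℝ) ≤ |(p.2 : ℝ)| := by
    exact_mod_cast Int.one_le_abs (right_ne_zero_of_mul hp)
  rw [latSize, abs_mul]
  nlinarith

/-- The additive character `τ ↦ q^(-bc) = exp(-2πi bc τ)` attached to `(b, c)`. -/
noncomputable def qChar (p : ℤ × ℤ) (τ : ℂ) : ℂ :=
  Complex.exp (-(2 * Real.pi * Complex.I) * (p.1 * p.2) * τ)

lemma norm_qChar (p : ℤ × ℤ) (τ : ℂ) :
    ‖qChar p τ‖ = Real.exp (2 * Real.pi * τ.im * (p.1 * p.2)) := by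
  rw [qChar, Complex.norm_exp]
  congr 1
  simp [Complex.mul_re, Complex.mul_im]
  ring

/-- The Gaussian `exp(-π v (x + y)²)`, in the coordinates of `(b, c)`. -/
noncomputable def latGauss (w v : ℝ) (p : ℤ × ℤ) : ℝ :=
  Real.exp (-Real.pi * v * (latX w p + latY w p) ^ 2)

lemma latGauss_pos (w v : ℝ) (p : ℤ × ℤ) : 0 < latGauss w v p := Real.exp_pos _

/-- Multiplication by `|q^(-bc)|` turns the degenerate Gaussian into a definite one. -/
lemma latGauss_mul_norm_qChar (w : ℝ) (p : ℤ × ℤ) (τ : ℂ) :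
    latGauss w τ.im p * ‖qChar p τ‖ =
      Real.exp (-Real.pi * τ.im * (latX w p ^ 2 + latY w p ^ 2)) := by
  rw [norm_qChar, latGauss, ← Real.exp_add, ← latX_mul_latY w]
  congr 1
  ring

lemma latGauss_mul_norm_qChar_le {w W v₀ : ℝ} (hw : |w| ≤ W) (hv₀ : 0 < v₀) (p : ℤ × ℤ)
    {τ : ℂ} (hτ : v₀ ≤ τ.im) :
    latGauss w τ.im p * ‖qChar p τ‖ ≤
      Real.exp (-(Real.pi * v₀ * Real.exp (-2 * W)) * latSize p) := by
  rw [latGauss_mul_norm_qChar]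
  refine Real.exp_le_exp.2 ?_
  have h := mul_le_mul (mul_le_mul_of_nonneg_left hτ Real.pi_pos.le) (latSize_le_sq_add_sq hw p)
    (mul_nonneg (Real.exp_pos _).le (latSize_nonneg p)) (mul_pos Real.pi_pos (hv₀.trans_le hτ)).le
  linarith

/-- A coefficient that is of Gaussian size for `bc ≥ 0` and of linear size always gives terms
of exponential decay in all lattice directions. -/
lemma abs_mul_norm_qChar_le {w W v₀ C φ : ℝ} (hw : |w| ≤ W) (hv₀ : 0 < v₀) (p : ℤ × ℤ)
    {τ : ℂ} (hτ : v₀ ≤ τ.im) (hC : 0 ≤ C) (h1 : 0 ≤ p.1 * p.2 → |φ| ≤ C * latGauss w τ.im p)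
    (h2 : |φ| ≤ C * (1 + latSize p)) :
    |φ| * ‖qChar p τ‖ ≤
      C * ((1 + latSize p) ^ 1 * Real.exp (-(Real.pi * v₀ * Real.exp (-2 * W)) * latSize p)) := by
  have hs := latSize_nonneg p
  rw [pow_one]
  rcases le_or_gt 0 (p.1 * p.2) with h | h
  · calc |φ| * ‖qChar p τ‖ ≤ C * latGauss w τ.im p * ‖qChar p τ‖ := by gcongr; exact h1 h
      _ = C * (1 * (latGauss w τ.im p * ‖qChar p τ‖)) := by ring
      _ ≤ _ := by
        have := latGauss_mul_norm_qChar_le hw hv₀ p hτ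
        have h0 := latGauss_pos w τ.im p
        gcongr
        linarith
  · have hq : ‖qChar p τ‖ ≤ Real.exp (-(Real.pi * v₀ * Real.exp (-2 * W)) * latSize p) := by
      rw [norm_qChar]
      refine Real.exp_le_exp.2 ?_
      have h3 := latSize_le_two_mul_abs h.ne
      rw [abs_of_neg (by exact_mod_cast h)] at h3
      have h4 : Real.exp (-2 * W) ≤ 1 :=
        Real.exp_le_one_iff.2 (by linarith [(abs_nonneg w).trans hw])
      have h5 : v₀ * Real.exp (-2 * W) ≤ τ.im := by nlinarith
      have h6 : v₀ * Real.exp (-2 * W) * latSize p ≤ τ.im * (2 * -((p.1 : ℝ) * p.2)) := by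
        gcongr
        linarith
      nlinarith [mul_le_mul_of_nonneg_left h6 Real.pi_pos.le]
    rw [← mul_assoc]
    gcongr

/-! ### The coefficients and their derivatives -/

/-- Half of `(B - I) / √v`, as a function of `x = b / s` and `y = c s`. Written with `η`, the
case distinction in `I` turns into `π |x| + π |y|`. -/
noncomputable def bdryTerm (v x y : ℝ) : ℝ :=
  softAbs (√v * (x + y)) / √v - Real.pi * |x| - Real.pi * |y|

/-- The derivative of `bdryTerm` along the flow `(x, y) ↦ (exp (-w) x, exp w y)`. -/
noncomputable def bdryTermFlow (v x y : ℝ) : ℝ :=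
  gaussPrim (√v * (x + y)) * (y - x) + Real.pi * |x| - Real.pi * |y|

lemma gauss_sqrt_mul {v : ℝ} (hv : 0 ≤ v) (X : ℝ) :
    Real.exp (-Real.pi * (√v * X) ^ 2) = Real.exp (-Real.pi * v * X ^ 2) := by
  rw [mul_pow, Real.sq_sqrt hv, mul_assoc]

lemma bdryTerm_eq {v : ℝ} (hv : 0 < v) (x y : ℝ) :
    bdryTerm v x y = (softAbs (√v * (x + y)) - Real.pi * |√v * (x + y)|) / √v
      - Real.pi * (|x| + |y| - |x + y|) := by
  have : 0 < √v := Real.sqrt_pos.2 hv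
  rw [bdryTerm, abs_mul, abs_of_pos this]
  field_simp
  ring

lemma abs_bdryTerm_le_gauss {v x y : ℝ} (hv : 0 < v) (hxy : 0 ≤ x * y) :
    |bdryTerm v x y| ≤ 1 / √v * Real.exp (-Real.pi * v * (x + y) ^ 2) := by
  have hq : 0 < √v := Real.sqrt_pos.2 hv
  have h0 : |x| + |y| - |x + y| = 0 := by
    rcases mul_nonneg_iff.1 hxy with ⟨h1, h2⟩ | ⟨h1, h2⟩
    · rw [abs_of_nonneg h1, abs_of_nonneg h2, abs_of_nonneg (add_nonneg h1 h2)]; ring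
    · rw [abs_of_nonpos h1, abs_of_nonpos h2, abs_of_nonpos (add_nonpos h1 h2)]; ring
  rw [bdryTerm_eq hv, h0, mul_zero, sub_zero,
    abs_of_nonneg (div_nonneg (softAbs_sub_nonneg _) hq.le), div_eq_inv_mul, one_div,
    ← gauss_sqrt_mul hv.le]
  gcongr
  exact softAbs_sub_le _

lemma abs_add_abs_sub_le (x y : ℝ) (h : 1 ≤ |x * y|) : |x| + |y| - |x + y| ≤ 2 * |x * y| := by
  rw [abs_mul] at *
  have h1 : |x| ≤ |x + y| + |y| := by
    have := abs_sub (x + y) y; simpa using this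
  have h2 : |y| ≤ |x + y| + |x| := by
    have := abs_sub (x + y) x; simpa using this
  by_contra! hc
  have hx : |x| * |y| < |x| := by linarith
  have hy : |x| * |y| < |y| := by linarith
  nlinarith [abs_nonneg x, abs_nonneg y]

lemma softAbs_error_le {v : ℝ} (X : ℝ) :
    (softAbs (√v * X) - Real.pi * |√v * X|) / √v ≤ 1 / √v := by
  have h := (softAbs_sub_le (√v * X)).trans
    (Real.exp_le_one_iff.2 (by have := Real.pi_pos; nlinarith [sq_nonneg (√v * X)]))
  gcongr

lemma abs_bdryTerm_le {v : ℝ} (hv : 0 < v) (x y : ℝ) :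
    |bdryTerm v x y| ≤ 1 / √v + Real.pi * (|x| + |y|) := by
  have h1 := softAbs_error_le (v := v) (x + y)
  have h2 : 0 ≤ (softAbs (√v * (x + y)) - Real.pi * |√v * (x + y)|) / √v :=
    div_nonneg (softAbs_sub_nonneg _) (Real.sqrt_nonneg _)
  have h3 := mul_le_mul_of_nonneg_left (abs_add_le x y) Real.pi_pos.le
  have h4 : 0 ≤ Real.pi * |x + y| := by have := Real.pi_pos; positivity
  have h5 : 0 ≤ Real.pi * (|x| + |y|) := by have := Real.pi_pos; positivity
  rw [bdryTerm_eq hv, abs_le]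
  constructor <;> linarith

/-- A bound that depends only on the product `x y`. -/
lemma abs_bdryTerm_le_mul {v x y : ℝ} (hv : 0 < v) (h : 1 ≤ |x * y|) :
    |bdryTerm v x y| ≤ 1 / √v + 2 * Real.pi * |x * y| := by
  have h1 := softAbs_error_le (v := v) (x + y)
  have h2 : 0 ≤ (softAbs (√v * (x + y)) - Real.pi * |√v * (x + y)|) / √v :=
    div_nonneg (softAbs_sub_nonneg _) (Real.sqrt_nonneg _)
  have h3 := mul_le_mul_of_nonneg_left (abs_add_le x y) Real.pi_pos.le
  have h4 := mul_le_mul_of_nonneg_left (abs_add_abs_sub_le x y h) Real.pi_pos.le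
  have h5 : 0 ≤ Real.pi * |x * y| := by have := Real.pi_pos; positivity
  have h6 : 0 ≤ 1 / √v := by positivity
  rw [bdryTerm_eq hv, abs_le]
  constructor <;> linarith

lemma abs_bdryTermFlow_le_gauss {v x y : ℝ} (hv : 0 < v) (hxy : 0 ≤ x * y) :
    |bdryTermFlow v x y| ≤ 1 / √v * Real.exp (-Real.pi * v * (x + y) ^ 2) := by
  wlog h : 0 ≤ x ∧ 0 ≤ y generalizing x y
  · have h' : x ≤ 0 ∧ y ≤ 0 := (mul_nonneg_iff.1 hxy).resolve_left h
    have := this (x := -x) (y := -y) (by linarith) ⟨by linarith, by linarith⟩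
    rw [bdryTermFlow, ← neg_add, mul_neg, gaussPrim_neg, neg_sq, abs_neg, abs_neg] at this
    rw [bdryTermFlow]
    convert! this using 2
    ring
  obtain ⟨hx, hy⟩ := h
  have hq : 0 < √v := Real.sqrt_pos.2 hv
  have h1 : bdryTermFlow v x y = (gaussPrim (√v * (x + y)) - Real.pi) * (y - x) := by
    rw [bdryTermFlow, abs_of_nonneg hx, abs_of_nonneg hy]; ring
  have h2 := abs_gaussPrim_mul_sub_le (√v * (x + y))
  rw [abs_of_nonneg (by positivity : 0 ≤ √v * (x + y)), mul_comm, ← sub_mul, abs_mul,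
    abs_of_nonneg (by positivity : 0 ≤ √v * (x + y)), gauss_sqrt_mul hv.le] at h2
  have h3 : |y - x| ≤ x + y := abs_le.2 ⟨by linarith, by linarith⟩
  rw [h1, abs_mul, one_div, ← div_eq_inv_mul, le_div_iff₀ hq]
  refine le_trans ?_ h2
  rw [mul_assoc, mul_comm √v]
  gcongr

lemma abs_bdryTermFlow_le (v x y : ℝ) :
    |bdryTermFlow v x y| ≤ 2 * Real.pi * (|x| + |y|) := by
  have hp := Real.pi_pos
  have h1 : |gaussPrim (√v * (x + y)) * (y - x)| ≤ Real.pi * (|x| + |y|) := by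
    rw [abs_mul]
    have := abs_sub y x
    have := abs_gaussPrim_le (√v * (x + y))
    gcongr
    linarith
  obtain ⟨h2, h3⟩ := abs_le.1 h1
  have h4 : 0 ≤ Real.pi * |x| := by positivity
  have h5 : 0 ≤ Real.pi * |y| := by positivity
  rw [bdryTermFlow, abs_le]
  constructor <;> linarith

lemma abs_latX (w : ℝ) (p : ℤ × ℤ) : |latX w p| = |(p.1 : ℝ)| * Real.exp (-w) := by
  rw [latX, abs_mul, Real.abs_exp]

lemma abs_latY (w : ℝ) (p : ℤ × ℤ) : |latY w p| = |(p.2 : ℝ)| * Real.exp w := by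
  rw [latY, abs_mul, Real.abs_exp]

lemma hasDerivAt_mul_exp_neg (a w : ℝ) :
    HasDerivAt (fun w => a * Real.exp (-w)) (-(a * Real.exp (-w))) w := by
  have := ((hasDerivAt_neg w).exp).const_mul a
  convert! this using 1
  ring

lemma hasDerivAt_mul_exp (a w : ℝ) :
    HasDerivAt (fun w => a * Real.exp w) (a * Real.exp w) w :=
  (Real.hasDerivAt_exp w).const_mul a

lemma hasDerivAt_latX_add_latY (v w : ℝ) (p : ℤ × ℤ) :
    HasDerivAt (fun w => √v * (latX w p + latY w p)) (√v * (latY w p - latX w p)) w := by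
  have := ((hasDerivAt_mul_exp_neg p.1 w).add (hasDerivAt_mul_exp p.2 w)).const_mul √v
  convert! this using 1
  rw [latX, latY]
  ring

lemma hasDerivAt_bdryTerm_flow {v : ℝ} (hv : 0 < v) (w : ℝ) (p : ℤ × ℤ) :
    HasDerivAt (fun w => bdryTerm v (latX w p) (latY w p))
      (bdryTermFlow v (latX w p) (latY w p)) w := by
  have hq : √v ≠ 0 := (Real.sqrt_pos.2 hv).ne'
  have h1 := ((hasDerivAt_softAbs _).comp w (hasDerivAt_latX_add_latY v w p)).div_const √v
  have h2 := (hasDerivAt_mul_exp_neg |(p.1 : ℝ)| w).const_mul Real.pi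
  have h3 := (hasDerivAt_mul_exp |(p.2 : ℝ)| w).const_mul Real.pi
  simp only [← abs_latX, ← abs_latY] at h2 h3
  convert! (h1.sub h2).sub h3 using 1
  rw [bdryTermFlow]
  field_simp
  ring

/-- Along the flow, `∂² - 1` turns the coefficient into a quadratic polynomial times a
Gaussian. -/
lemma hasDerivAt_bdryTermFlow_flow {v : ℝ} (hv : 0 < v) (w : ℝ) (p : ℤ × ℤ) :
    HasDerivAt (fun w => bdryTermFlow v (latX w p) (latY w p))
      (bdryTerm v (latX w p) (latY w p)
        + 1 / √v * (2 * Real.pi * v * (latX w p - latY w p) ^ 2 - 1) * latGauss w v p) w := by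
  have hq : √v ≠ 0 := (Real.sqrt_pos.2 hv).ne'
  have h0 := (hasDerivAt_mul_exp p.2 w).sub (hasDerivAt_mul_exp_neg p.1 w)
  have h1 := ((hasDerivAt_gaussPrim _).comp w (hasDerivAt_latX_add_latY v w p)).mul h0
  have h2 := (hasDerivAt_mul_exp_neg |(p.1 : ℝ)| w).const_mul Real.pi
  have h3 := (hasDerivAt_mul_exp |(p.2 : ℝ)| w).const_mul Real.pi
  simp only [← abs_latX, ← abs_latY] at h2 h3
  convert! (h1.add h2).sub h3 using 1
  have hv2 : v = √v ^ 2 := (Real.sq_sqrt hv.le).symm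
  simp only [Pi.sub_apply, Function.comp, bdryTerm, softAbs]
  rw [gauss_sqrt_mul hv.le, ← latGauss, ← latX, ← latY]
  generalize latGauss w v p = E
  generalize gaussPrim (√v * (latX w p + latY w p)) = K
  rw [show 2 * Real.pi * v = 2 * Real.pi * √v ^ 2 by rw [← hv2]]
  field_simp
  ring

lemma hasDerivAt_latGauss (w v : ℝ) (p : ℤ × ℤ) :
    HasDerivAt (fun v => latGauss w v p)
      (-Real.pi * (latX w p + latY w p) ^ 2 * latGauss w v p) v := by
  have := ((hasDerivAt_id v).const_mul
    (-Real.pi)).mul_const ((latX w p + latY w p) ^ 2) |>.exp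
  convert! this using 1
  simp only [latGauss, id]
  ring

lemma hasDerivAt_bdryTerm {v : ℝ} (hv : 0 < v) (w : ℝ) (p : ℤ × ℤ) :
    HasDerivAt (fun v => bdryTerm v (latX w p) (latY w p))
      (-(1 / (2 * v * √v)) * latGauss w v p) v := by
  have hq : √v ≠ 0 := (Real.sqrt_pos.2 hv).ne'
  have h0 := Real.hasDerivAt_sqrt hv.ne'
  have h1 := ((((hasDerivAt_softAbs _).comp v (h0.mul_const (latX w p + latY w p))).div h0
    hq).sub_const (Real.pi * |latX w p|)).sub_const (Real.pi * |latY w p|)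
  convert! h1 using 1
  simp only [Function.comp, softAbs]
  rw [gauss_sqrt_mul hv.le, ← latGauss]
  have hv2 : v = √v ^ 2 := (Real.sq_sqrt hv.le).symm
  generalize latGauss w v p = E
  generalize gaussPrim (√v * (latX w p + latY w p)) = K
  rw [show 1 / (2 * v * √v) = 1 / (2 * √v ^ 2 * √v) by rw [← hv2]]
  field_simp
  ring

lemma abs_bdryTerm_mul_norm_qChar_le {w W v₀ : ℝ} (hw : |w| ≤ W) (hv₀ : 0 < v₀) (p : ℤ × ℤ)
    {τ : ℂ} (hτ : v₀ ≤ τ.im) :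
    |bdryTerm τ.im (latX w p) (latY w p)| * ‖qChar p τ‖ ≤
      (1 / √v₀ + 2 * Real.pi * Real.exp W) *
        ((1 + latSize p) ^ 1 * Real.exp (-(Real.pi * v₀ * Real.exp (-2 * W)) * latSize p)) := by
  have hpi := Real.pi_pos
  have hv := hv₀.trans_le hτ
  have hs := latSize_nonneg p
  have hq : 1 / √τ.im ≤ 1 / √v₀ :=
    one_div_le_one_div_of_le (Real.sqrt_pos.2 hv₀) (Real.sqrt_le_sqrt hτ)
  have hq' : 0 < 1 / √v₀ := one_div_pos.2 (Real.sqrt_pos.2 hv₀)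
  refine abs_mul_norm_qChar_le hw hv₀ p hτ (by positivity) (fun h => ?_) ?_
  · refine (abs_bdryTerm_le_gauss hv ?_).trans ?_
    · rw [latX_mul_latY]; exact_mod_cast h
    · rw [latGauss]
      gcongr
      have : 0 < 2 * Real.pi * Real.exp W := by positivity
      linarith
  · have h1 := mul_le_mul_of_nonneg_left (abs_latX_add_abs_latY_le hw p) hpi.le
    have h2 : 0 ≤ 1 / √v₀ * latSize p := by positivity
    have h3 : 0 ≤ Real.pi * (Real.exp W * latSize p) := by positivity
    have h4 : 0 ≤ Real.pi * Real.exp W := by positivity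
    linarith [abs_bdryTerm_le hv (latX w p) (latY w p)]

lemma abs_bdryTermFlow_mul_norm_qChar_le {w W v₀ : ℝ} (hw : |w| ≤ W) (hv₀ : 0 < v₀) (p : ℤ × ℤ)
    {τ : ℂ} (hτ : v₀ ≤ τ.im) :
    |bdryTermFlow τ.im (latX w p) (latY w p)| * ‖qChar p τ‖ ≤
      (1 / √v₀ + 2 * Real.pi * Real.exp W) *
        ((1 + latSize p) ^ 1 * Real.exp (-(Real.pi * v₀ * Real.exp (-2 * W)) * latSize p)) := by
  have hpi := Real.pi_pos
  have hv := hv₀.trans_le hτ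
  have hs := latSize_nonneg p
  have hq : 1 / √τ.im ≤ 1 / √v₀ :=
    one_div_le_one_div_of_le (Real.sqrt_pos.2 hv₀) (Real.sqrt_le_sqrt hτ)
  have hq' : 0 < 1 / √v₀ := one_div_pos.2 (Real.sqrt_pos.2 hv₀)
  refine abs_mul_norm_qChar_le hw hv₀ p hτ (by positivity) (fun h => ?_) ?_
  · refine (abs_bdryTermFlow_le_gauss hv ?_).trans ?_
    · rw [latX_mul_latY]; exact_mod_cast h
    · rw [latGauss]
      gcongr
      have : 0 < 2 * Real.pi * Real.exp W := by positivity
      linarith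
  · have h1 := mul_le_mul_of_nonneg_left (abs_latX_add_abs_latY_le hw p) hpi.le
    have h2 : 0 ≤ 1 / √v₀ * latSize p := by positivity
    have h4 : 0 ≤ Real.pi * Real.exp W := by positivity
    linarith [abs_bdryTermFlow_le τ.im (latX w p) (latY w p)]

/-! ### Smoothness of lattice series in the modular variable -/

/-- The series `∑_{b,c} φ_{b,c}(v) q^(-bc)` attached to a family of functions of `v = Im τ`. -/
noncomputable def latSeries (φ : ℤ × ℤ → ℝ → ℂ) (τ : ℂ) : ℂ := ∑' p, φ p τ.im * qChar p τ

/-- The terms `φ_{b,c}(v) q^(-bc)` decay exponentially in `(b, c)`, uniformly on each half plane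
`v ≥ v₀ > 0`. -/
def IsAdmissible (φ : ℤ × ℤ → ℝ → ℂ) : Prop :=
  ∀ v₀ : ℝ, 0 < v₀ → ∃ (C : ℝ) (k : ℕ) (β : ℝ), 0 < β ∧ ∀ τ : ℂ, v₀ ≤ τ.im → ∀ p,
    ‖φ p τ.im * qChar p τ‖ ≤ C * ((1 + latSize p) ^ k * Real.exp (-β * latSize p))

/-- A weight on the lattice of at most polynomial growth. -/
def IsPolyBounded (P : ℤ × ℤ → ℂ) : Prop :=
  ∃ (C : ℝ) (k : ℕ), ∀ p, ‖P p‖ ≤ C * (1 + latSize p) ^ k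

lemma IsPolyBounded.mul {P Q : ℤ × ℤ → ℂ} (hP : IsPolyBounded P) (hQ : IsPolyBounded Q) :
    IsPolyBounded fun p => P p * Q p := by
  obtain ⟨C, k, hC⟩ := hP
  obtain ⟨D, l, hD⟩ := hQ
  refine ⟨C * D, k + l, fun p => ?_⟩
  rw [norm_mul]
  refine (mul_le_mul (hC p) (hD p) (norm_nonneg _) ((norm_nonneg _).trans (hC p))).trans_eq ?_
  ring

lemma isPolyBounded_const (a : ℂ) : IsPolyBounded fun _ => a := ⟨‖a‖, 0, fun p => by simp⟩

lemma isPolyBounded_mul_coords : IsPolyBounded fun p => (p.1 * p.2 : ℂ) := by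
  refine ⟨1, 2, fun p => ?_⟩
  have h1 := abs_nonneg (p.1 : ℝ)
  have h2 := abs_nonneg (p.2 : ℝ)
  simp only [norm_mul, Complex.norm_intCast, latSize]
  nlinarith

lemma isPolyBounded_sq_flow (w : ℝ) :
    IsPolyBounded fun p => (((latX w p + latY w p) ^ 2 : ℝ) : ℂ) := by
  refine ⟨Real.exp |w| ^ 2, 2, fun p => ?_⟩
  have h1 := (abs_add_le _ _).trans (abs_latX_add_abs_latY_le (le_refl |w|) p)
  have h2 := latSize_nonneg p
  rw [Complex.norm_real, Real.norm_eq_abs, abs_pow, ← mul_pow]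
  gcongr
  refine h1.trans ?_
  gcongr
  linarith

lemma IsAdmissible.mul {φ : ℤ × ℤ → ℝ → ℂ} (hφ : IsAdmissible φ) {P : ℤ × ℤ → ℂ}
    (hP : IsPolyBounded P) : IsAdmissible fun p v => P p * φ p v := by
  intro v₀ hv₀
  obtain ⟨C, k, β, hβ, h⟩ := hφ v₀ hv₀
  obtain ⟨D, l, hD⟩ := hP
  refine ⟨D * C, l + k, β, hβ, fun τ hτ p => ?_⟩
  rw [mul_assoc, norm_mul]
  refine (mul_le_mul (hD p) (h τ hτ p) (norm_nonneg _) ((norm_nonneg _).trans (hD p))).trans_eq ?_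
  ring

lemma IsAdmissible.mul_im {φ : ℤ × ℤ → ℝ → ℂ} (hφ : IsAdmissible φ) {f : ℝ → ℂ}
    (hf : ∀ v₀ : ℝ, 0 < v₀ → ∃ C, ∀ v, v₀ ≤ v → ‖f v‖ ≤ C) :
    IsAdmissible fun p v => f v * φ p v := by
  intro v₀ hv₀
  obtain ⟨C, k, β, hβ, h⟩ := hφ v₀ hv₀
  obtain ⟨D, hD⟩ := hf v₀ hv₀
  refine ⟨D * C, k, β, hβ, fun τ hτ p => ?_⟩
  rw [mul_assoc, norm_mul, mul_assoc]
  exact mul_le_mul (hD _ hτ) (h τ hτ p) (norm_nonneg _) ((norm_nonneg _).trans (hD _ hτ))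

lemma isAdmissible_bdryTerm (w : ℝ) :
    IsAdmissible fun p v => (bdryTerm v (latX w p) (latY w p) : ℂ) := by
  intro v₀ hv₀
  refine ⟨1 / √v₀ + 2 * Real.pi * Real.exp |w|, 1, Real.pi * v₀ * Real.exp (-2 * |w|),
    by have := Real.pi_pos; positivity, fun τ hτ p => ?_⟩
  rw [norm_mul, Complex.norm_real, Real.norm_eq_abs]
  exact abs_bdryTerm_mul_norm_qChar_le (le_refl |w|) hv₀ p hτ

lemma isAdmissible_latGauss (w : ℝ) : IsAdmissible fun p v => (latGauss w v p : ℂ) := by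
  intro v₀ hv₀
  refine ⟨1, 0, Real.pi * v₀ * Real.exp (-2 * |w|),
    by have := Real.pi_pos; positivity, fun τ hτ p => ?_⟩
  rw [norm_mul, Complex.norm_real, Real.norm_eq_abs, abs_of_pos (latGauss_pos _ _ _), one_mul,
    pow_zero, one_mul]
  exact latGauss_mul_norm_qChar_le (le_refl |w|) hv₀ p hτ

lemma IsAdmissible.summable {φ : ℤ × ℤ → ℝ → ℂ} (hφ : IsAdmissible φ) {τ : ℂ} (hτ : 0 < τ.im) :
    Summable fun p => φ p τ.im * qChar p τ := by
  obtain ⟨C, k, β, hβ, h⟩ := hφ _ hτ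
  exact Summable.of_norm_bounded ((summable_majorant k hβ).mul_left C) (h τ le_rfl)

/-- The real-linear map `τ ↦ Im τ`, with values in `ℂ`. -/
noncomputable def imC : ℂ →L[ℝ] ℂ := Complex.ofRealCLM.comp Complex.imCLM

lemma hasDerivAt_qChar (p : ℤ × ℤ) (τ : ℂ) :
    HasDerivAt (qChar p) (-(2 * Real.pi * Complex.I) * (p.1 * p.2) * qChar p τ) τ := by
  have := ((hasDerivAt_id τ).const_mul (-(2 * Real.pi * Complex.I) * (p.1 * p.2))).cexp
  convert! this using 1
  simp only [qChar, id]
  ring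

/-- Termwise differentiation: the derivative along `τ` multiplies the coefficients by `-2πi bc`,
and the one along `v` differentiates them. -/
lemma hasFDerivAt_latSeries {φ φ' : ℤ × ℤ → ℝ → ℂ} (hφ : IsAdmissible φ) (hφ' : IsAdmissible φ')
    (hd : ∀ p v, 0 < v → HasDerivAt (φ p) (φ' p v) v) {τ : ℂ} (hτ : 0 < τ.im) :
    HasFDerivAt (latSeries φ)
      (latSeries (fun p v => -(2 * Real.pi * Complex.I) * (p.1 * p.2) * φ p v) τ
          • ContinuousLinearMap.id ℝ ℂ
        + latSeries φ' τ • imC) τ := by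
  have hψ : IsAdmissible fun p v => -(2 * Real.pi * Complex.I) * (p.1 * p.2) * φ p v :=
    hφ.mul ((isPolyBounded_const _).mul isPolyBounded_mul_coords)
  have hv₀ : 0 < τ.im / 2 := by linarith
  obtain ⟨C, k, β, hβ, h⟩ := hψ _ hv₀
  obtain ⟨C', k', β', hβ', h'⟩ := hφ' _ hv₀
  have hu := (((summable_majorant k hβ).mul_left C).mul_right ‖ContinuousLinearMap.id ℝ ℂ‖).add
    (((summable_majorant k' hβ').mul_left C').mul_right ‖imC‖)
  have key := hasFDerivAt_tsum_of_isPreconnected (𝕜 := ℝ) hu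
    (s := {z : ℂ | τ.im / 2 < z.im}) (x₀ := τ) (x := τ)
    (f := fun p τ => φ p τ.im * qChar p τ)
    (f' := fun p τ => (-(2 * Real.pi * Complex.I) * (p.1 * p.2) * φ p τ.im * qChar p τ)
      • ContinuousLinearMap.id ℝ ℂ + (φ' p τ.im * qChar p τ) • imC)
    (isOpen_lt continuous_const Complex.continuous_im)
    (convex_halfSpace_im_gt _).isPreconnected ?_ ?_ (by simpa using hτ) (hφ.summable hτ)
    (by simpa using hτ)
  · have h1 := ((hψ.summable hτ).hasSum.smul_const (ContinuousLinearMap.id ℝ ℂ)).add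
      ((hφ'.summable hτ).hasSum.smul_const imC)
    convert! key using 1
    exact h1.tsum_eq.symm
  · intro p z hz
    have hz' : 0 < z.im := hv₀.trans hz
    have h1 : HasFDerivAt (fun z : ℂ => φ p z.im)
        ((ContinuousLinearMap.toSpanSingleton ℝ (φ' p z.im)).comp Complex.imCLM) z :=
      (hd p _ hz').hasFDerivAt.comp z Complex.imCLM.hasFDerivAt
    have h2 := (hasDerivAt_qChar p z).hasFDerivAt.restrictScalars ℝ
    convert! h1.mul h2 using 1
    ext y
    simp [imC]
    ring
  · intro p z hz
    refine (norm_add_le _ _).trans (add_le_add ?_ ?_)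
    · rw [norm_smul]
      exact mul_le_mul_of_nonneg_right (h z hz.le p) (norm_nonneg _)
    · rw [norm_smul]
      exact mul_le_mul_of_nonneg_right (h' z hz.le p) (norm_nonneg _)

lemma isOpen_upperHalf : IsOpen {τ : ℂ | 0 < τ.im} :=
  isOpen_lt continuous_const Complex.continuous_im

lemma contDiffOn_succ_of_hasFDerivAt {f A B : ℂ → ℂ} {n : ℕ}
    (hf : ∀ τ : ℂ, 0 < τ.im → HasFDerivAt f (A τ • ContinuousLinearMap.id ℝ ℂ + B τ • imC) τ)
    (hA : ContDiffOn ℝ n A {τ | 0 < τ.im}) (hB : ContDiffOn ℝ n B {τ | 0 < τ.im}) :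
    ContDiffOn ℝ (n + 1 : ℕ) f {τ | 0 < τ.im} := by
  push_cast
  rw [contDiffOn_succ_iff_fderiv_of_isOpen isOpen_upperHalf]
  refine ⟨fun τ hτ => (hf τ hτ).differentiableAt.differentiableWithinAt, by simp, ?_⟩
  exact ((hA.smul contDiffOn_const).add (hB.smul contDiffOn_const)).congr
    fun τ hτ => (hf τ hτ).fderiv

lemma hasFDerivAt_latSeries_latGauss (w : ℝ) {P : ℤ × ℤ → ℂ} (hP : IsPolyBounded P) {τ : ℂ}
    (hτ : 0 < τ.im) :
    HasFDerivAt (latSeries fun p v => P p * latGauss w v p)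
      (latSeries (fun p v => (-(2 * Real.pi * Complex.I) * (p.1 * p.2)) * P p
          * latGauss w v p) τ • ContinuousLinearMap.id ℝ ℂ
        + latSeries (fun p v => (-Real.pi * ((latX w p + latY w p) ^ 2 : ℝ)) * P p
          * latGauss w v p) τ • imC) τ := by
  have h2 : IsPolyBounded fun p => (-Real.pi * ((latX w p + latY w p) ^ 2 : ℝ)) * P p :=
    ((isPolyBounded_const (-Real.pi)).mul (isPolyBounded_sq_flow w)).mul hP
  have := hasFDerivAt_latSeries ((isAdmissible_latGauss w).mul hP)
    ((isAdmissible_latGauss w).mul h2) (fun p v _ => ?_) hτ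
  · simpa only [mul_assoc] using this
  · convert! ((hasDerivAt_latGauss w v p).ofReal_comp).const_mul (P p) using 1
    push_cast
    ring

lemma hasFDerivAt_latSeries_bdryTerm (w : ℝ) {P : ℤ × ℤ → ℂ} (hP : IsPolyBounded P) {τ : ℂ}
    (hτ : 0 < τ.im) :
    HasFDerivAt (latSeries fun p v => P p * bdryTerm v (latX w p) (latY w p))
      (latSeries (fun p v => (-(2 * Real.pi * Complex.I) * (p.1 * p.2)) * P p
          * bdryTerm v (latX w p) (latY w p)) τ • ContinuousLinearMap.id ℝ ℂ
        + (((-(1 / (2 * τ.im * √τ.im)) : ℝ) : ℂ)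
          * latSeries (fun p v => P p * latGauss w v p) τ) • imC) τ := by
  have hφ' : IsAdmissible fun p v => ((-(1 / (2 * v * √v)) : ℝ) : ℂ) * (P p * latGauss w v p) := by
    refine ((isAdmissible_latGauss w).mul hP).mul_im fun v₀ hv₀ =>
      ⟨1 / (2 * v₀ * √v₀), fun v hv => ?_⟩
    have hv' := hv₀.trans_le hv
    have := Real.sqrt_pos.2 hv₀
    rw [Complex.norm_real, norm_neg, Real.norm_of_nonneg (by positivity)]
    gcongr
  have := hasFDerivAt_latSeries ((isAdmissible_bdryTerm w).mul hP) hφ' (fun p v hv => ?_) hτ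
  · convert! this using 3
    · simp only [mul_assoc]
    · rw [latSeries, latSeries, ← tsum_mul_left]
      simp only [mul_assoc]
  · convert! ((hasDerivAt_bdryTerm hv w p).ofReal_comp).const_mul (P p) using 1
    push_cast
    ring

lemma contDiffOn_latSeries_latGauss (w : ℝ) (n : ℕ) {P : ℤ × ℤ → ℂ} (hP : IsPolyBounded P) :
    ContDiffOn ℝ n (latSeries fun p v => P p * latGauss w v p) {τ | 0 < τ.im} := by
  induction n generalizing P with
  | zero =>
    exact contDiffOn_zero.2 fun τ hτ =>
      (hasFDerivAt_latSeries_latGauss w hP hτ).continuousAt.continuousWithinAt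
  | succ n ih =>
    exact contDiffOn_succ_of_hasFDerivAt (fun τ hτ => hasFDerivAt_latSeries_latGauss w hP hτ)
      (ih (((isPolyBounded_const _).mul isPolyBounded_mul_coords).mul hP))
      (ih (((isPolyBounded_const (-Real.pi)).mul (isPolyBounded_sq_flow w)).mul hP))

lemma contDiffOn_latSeries_bdryTerm (w : ℝ) (n : ℕ) {P : ℤ × ℤ → ℂ} (hP : IsPolyBounded P) :
    ContDiffOn ℝ n (latSeries fun p v => P p * bdryTerm v (latX w p) (latY w p))
      {τ | 0 < τ.im} := by
  induction n generalizing P with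
  | zero =>
    exact contDiffOn_zero.2 fun τ hτ =>
      (hasFDerivAt_latSeries_bdryTerm w hP hτ).continuousAt.continuousWithinAt
  | succ n ih =>
    refine contDiffOn_succ_of_hasFDerivAt (fun τ hτ => hasFDerivAt_latSeries_bdryTerm w hP hτ)
      (ih (((isPolyBounded_const _).mul isPolyBounded_mul_coords).mul hP))
      (ContDiffOn.mul ?_ (contDiffOn_latSeries_latGauss w n hP))
    have him : ContDiffOn ℝ n Complex.im {τ | 0 < τ.im} := Complex.imCLM.contDiff.contDiffOn
    refine Complex.ofRealCLM.contDiff.comp_contDiffOn (ContDiffOn.neg (ContDiffOn.div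
      contDiffOn_const ((contDiffOn_const.mul him).mul (him.sqrt fun τ hτ => ?_)) fun τ hτ => ?_))
    · exact (ne_of_gt hτ)
    · have : 0 < √τ.im := Real.sqrt_pos.2 hτ
      have : 0 < τ.im := hτ
      positivity

/-! ### Poisson summation for a quadratic polynomial times a Gaussian -/

lemma isBigO_quadratic_mul_cexp {A : ℂ} (hA : A.re < 0) (B α β γ : ℂ) :
    (fun t : ℝ => (α * t ^ 2 + β * t + γ) * Complex.exp (A * t ^ 2 + B * t))
      =O[cocompact ℝ] fun t => |t| ^ (-2 : ℝ) := by
  have h1 : (fun t : ℝ => α * (t : ℂ) ^ 2 + β * t + γ) =O[cocompact ℝ] fun t => |t| ^ (2 : ℝ) := by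
    refine Asymptotics.IsBigO.of_bound (‖α‖ + ‖β‖ + ‖γ‖) ?_
    filter_upwards [(tendsto_norm_cocompact_atTop (E := ℝ)).eventually_ge_atTop 1] with t ht
    rw [Real.norm_eq_abs] at ht
    have h2 : |t| ≤ |t| ^ 2 := by nlinarith
    have h3 : 1 ≤ |t| ^ 2 := by nlinarith
    rw [Real.rpow_two, Real.norm_of_nonneg (sq_nonneg _)]
    refine (norm_add₃_le).trans ?_
    rw [norm_mul, norm_mul, norm_pow, Complex.norm_real, Real.norm_eq_abs, add_mul, add_mul]
    gcongr
    exact le_mul_of_one_le_right (norm_nonneg _) h3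
  have h2 := h1.mul (cexp_neg_quadratic_isLittleO_abs_rpow_cocompact hA B (-4)).isBigO
  refine h2.congr' EventuallyEq.rfl ?_
  filter_upwards [(tendsto_norm_cocompact_atTop (E := ℝ)).eventually_ge_atTop 1] with t ht
  rw [Real.norm_eq_abs] at ht
  rw [← Real.rpow_add (by linarith)]
  norm_num

lemma integrable_pow_mul_cexp {a : ℝ} (ha : 0 < a) (θ : ℝ) (k : ℕ) :
    Integrable fun t : ℝ => (t : ℂ) ^ k *
      Complex.exp (-Real.pi * a * t ^ 2 + 2 * Real.pi * (-Complex.I * θ) * t) := by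
  have h := integrable_rpow_mul_exp_neg_mul_sq (b := Real.pi * a) (mul_pos Real.pi_pos ha)
    (s := k) (by have : (0 : ℝ) ≤ k := k.cast_nonneg; linarith)
  refine h.mono (by fun_prop) (Eventually.of_forall fun t => le_of_eq ?_)
  have : (-Real.pi * a * (t : ℂ) ^ 2 + 2 * Real.pi * (-Complex.I * θ) * t)
      = ((-(Real.pi * a) * t ^ 2 : ℝ) : ℂ) + ((-2 * Real.pi * θ * t : ℝ) : ℂ) * Complex.I := by
    push_cast; ring
  rw [norm_mul, norm_pow, Complex.norm_real, this, Complex.exp_add, norm_mul,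
    Complex.norm_exp_ofReal_mul_I, mul_one, Complex.norm_exp_ofReal, Real.rpow_natCast, norm_mul,
    norm_pow, Real.norm_of_nonneg (Real.exp_pos _).le]

/-- The Fourier transform of `(2πa (t - δ)² - 1)` times a modulated Gaussian, from two
differentiations of the Fourier transform of the Gaussian. -/
lemma fourier_quadratic_mul_gaussian {a : ℝ} (ha : 0 < a) (θ δ : ℝ) :
    (𝓕 fun t : ℝ => ((2 * Real.pi * a * ((t : ℂ) - δ) ^ 2 - 1) *
      Complex.exp (-Real.pi * a * t ^ 2 + 2 * Real.pi * (-Complex.I * θ) * t) : ℂ)) =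
    fun ξ : ℝ => 1 / (√a : ℂ) * (-(2 * Real.pi / a)) * (ξ + θ - Complex.I * a * δ) ^ 2 *
      Complex.exp (-Real.pi / a * ((ξ : ℂ) + θ) ^ 2) := by
  have hpi : (Real.pi : ℂ) ≠ 0 := by exact_mod_cast Real.pi_ne_zero
  have ha' : (a : ℂ) ≠ 0 := by exact_mod_cast ha.ne'
  set g : ℝ → ℂ := fun t =>
    Complex.exp (-Real.pi * a * t ^ 2 + 2 * Real.pi * (-Complex.I * θ) * t) with hg
  set E : ℝ → ℂ := fun ξ => Complex.exp (-Real.pi / a * ((ξ : ℂ) + θ) ^ 2) with hE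
  have hint (k : ℕ) : Integrable fun t : ℝ => (t : ℂ) ^ k * g t := integrable_pow_mul_cexp ha θ k
  have hEd (ξ : ℝ) : HasDerivAt E (-(2 * Real.pi / a) * (ξ + θ) * E ξ) ξ := by
    have h1 : HasDerivAt (fun z : ℂ => Complex.exp (-Real.pi / a * (z + θ) ^ 2))
        (Complex.exp (-Real.pi / a * ((ξ : ℂ) + θ) ^ 2) *
          (-Real.pi / a * (2 * ((ξ : ℂ) + θ) ^ 1 * 1))) (ξ : ℂ) := by
      simpa using! (((((hasDerivAt_id (ξ : ℂ)).add_const (θ : ℂ)).pow 2).const_mul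
        (-Real.pi / a : ℂ)).cexp)
    convert! h1.comp_ofReal using 1
    simp only [hE]
    ring
  have h0 : 𝓕 g = fun ξ : ℝ => 1 / (√a : ℂ) * E ξ := by
    have hs : (a : ℂ) ^ (1 / 2 : ℂ) = (√a : ℂ) := by
      rw [Real.sqrt_eq_rpow, Complex.ofReal_cpow ha.le]
      norm_num
    rw [hg, fourier_gaussian_pi' (b := (a : ℂ)) (by simpa using ha), hs]
    ext ξ
    rw [show (ξ : ℂ) + Complex.I * (-Complex.I * θ) = ξ + θ by
      linear_combination (-(θ : ℂ)) * Complex.I_sq]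
  have h1 (ξ : ℝ) : 𝓕 (fun t : ℝ => (t : ℂ) ^ 1 * g t) ξ =
      1 / (√a : ℂ) * (-Complex.I * (ξ + θ) / a) * E ξ := by
    have hd := Real.hasDerivAt_fourier (f := g) (by simpa using hint 0)
      (by simpa using hint 1) ξ
    have hc : (fun t : ℝ => (-2 * Real.pi * Complex.I * t : ℂ) • g t)
        = (-2 * Real.pi * Complex.I : ℂ) • fun t : ℝ => (t : ℂ) ^ 1 * g t := by
      ext t; simp only [Pi.smul_apply, smul_eq_mul]; ring
    rw [h0, hc] at hd
    have hu := hd.unique ((hEd ξ).const_mul (1 / (√a : ℂ)))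
    rw [show 𝓕 ((-2 * Real.pi * Complex.I : ℂ) • fun t : ℝ => (t : ℂ) ^ 1 * g t) ξ
      = (-2 * Real.pi * Complex.I : ℂ) • 𝓕 (fun t : ℝ => (t : ℂ) ^ 1 * g t) ξ from
        congrFun (VectorFourier.fourierIntegral_const_smul _ _ _ _ _) ξ, smul_eq_mul] at hu
    have h2 : (-2 * Real.pi * Complex.I : ℂ) ≠ 0 := by simp [hpi]
    refine mul_left_cancel₀ h2 (hu.trans ?_)
    linear_combination (2 * Real.pi * (1 / (√a : ℂ)) * (ξ + θ) / a * E ξ) * (-Complex.I_sq)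
  have h2 (ξ : ℝ) : 𝓕 (fun t : ℝ => (t : ℂ) ^ 2 * g t) ξ =
      1 / (√a : ℂ) * (1 / (2 * Real.pi * a) - (ξ + θ) ^ 2 / a ^ 2) * E ξ := by
    have hd := Real.hasDerivAt_fourier (f := fun t : ℝ => (t : ℂ) ^ 1 * g t) (hint 1)
      (by
        refine (hint 2).congr (Eventually.of_forall fun t => ?_)
        simp only [Complex.real_smul]; ring) ξ
    have hc : (fun t : ℝ => (-2 * Real.pi * Complex.I * t : ℂ) • ((t : ℂ) ^ 1 * g t))
        = (-2 * Real.pi * Complex.I : ℂ) • fun t : ℝ => (t : ℂ) ^ 2 * g t := by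
      ext t; simp only [Pi.smul_apply, smul_eq_mul]; ring
    rw [funext h1, hc] at hd
    have hl : HasDerivAt (fun ξ : ℝ => 1 / (√a : ℂ) * (-Complex.I * (ξ + θ) / a))
        (1 / (√a : ℂ) * (-Complex.I * 1 / a)) ξ :=
      ((((Complex.ofRealCLM.hasDerivAt (x := ξ)).add_const (θ : ℂ)).const_mul
        (-Complex.I)).div_const (a : ℂ)).const_mul _
    have hu := hd.unique (hl.mul (hEd ξ))
    rw [show 𝓕 ((-2 * Real.pi * Complex.I : ℂ) • fun t : ℝ => (t : ℂ) ^ 2 * g t) ξ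
      = (-2 * Real.pi * Complex.I : ℂ) • 𝓕 (fun t : ℝ => (t : ℂ) ^ 2 * g t) ξ from
        congrFun (VectorFourier.fourierIntegral_const_smul _ _ _ _ _) ξ, smul_eq_mul] at hu
    have h2 : (-2 * Real.pi * Complex.I : ℂ) ≠ 0 := by simp [hpi]
    refine mul_left_cancel₀ h2 (hu.trans ?_)
    field_simp
    ring
  have hcomb : (fun t : ℝ => (2 * Real.pi * a * ((t : ℂ) - δ) ^ 2 - 1) * g t)
      = fun t : ℝ => (2 * Real.pi * a : ℂ) • ((t : ℂ) ^ 2 * g t)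
        + (-(4 * Real.pi * a * δ) : ℂ) • ((t : ℂ) ^ 1 * g t)
        + (2 * Real.pi * a * δ ^ 2 - 1 : ℂ) • g t := by
    ext t; simp only [smul_eq_mul]; ring
  have hlin (ξ : ℝ) : 𝓕 (fun t : ℝ => ((2 * Real.pi * a * ((t : ℂ) - δ) ^ 2 - 1) * g t : ℂ)) ξ
      = (2 * Real.pi * a : ℂ) * 𝓕 (fun t : ℝ => (t : ℂ) ^ 2 * g t) ξ
        + (-(4 * Real.pi * a * δ) : ℂ) * 𝓕 (fun t : ℝ => (t : ℂ) ^ 1 * g t) ξ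
        + (2 * Real.pi * a * δ ^ 2 - 1 : ℂ) * 𝓕 g ξ := by
    have i2 := (Real.fourierIntegral_convergent_iff ξ).2 (hint 2)
    have i1 := (Real.fourierIntegral_convergent_iff ξ).2 (hint 1)
    have i0 := (Real.fourierIntegral_convergent_iff ξ).2
      (show Integrable g by simpa using hint 0)
    rw [hcomb]
    simp only [Real.fourier_eq]
    simp only [smul_add, smul_comm (Real.fourierChar _) (_ : ℂ)]
    have j2 := i2.smul (2 * Real.pi * a : ℂ)
    have j1 := i1.smul (-(4 * Real.pi * a * δ) : ℂ)
    refine (integral_add (j2.add j1) (i0.smul (2 * Real.pi * a * δ ^ 2 - 1 : ℂ))).trans ?_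
    congr 1
    · refine (integral_add j2 j1).trans ?_
      congr 1 <;> exact integral_const_mul (L := ℂ) _ _
    · exact integral_const_mul (L := ℂ) _ _
  ext ξ
  rw [hlin, h2, h1, h0]
  change _ = 1 / (√a : ℂ) * (-(2 * Real.pi / a)) * (ξ + θ - Complex.I * a * δ) ^ 2 * E ξ
  beta_reduce
  generalize E ξ = e
  generalize 1 / (√a : ℂ) = r
  field_simp
  linear_combination (2 * Real.pi * a ^ 2 * δ ^ 2 * e * r : ℂ) * Complex.I_sq

lemma tsum_quadratic_mul_gaussian {a : ℝ} (ha : 0 < a) (θ δ : ℝ) :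
    ∑' n : ℤ, (2 * Real.pi * a * ((n : ℂ) - δ) ^ 2 - 1) *
      Complex.exp (-Real.pi * a * n ^ 2 + 2 * Real.pi * (-Complex.I * θ) * n) =
    ∑' n : ℤ, 1 / (√a : ℂ) * (-(2 * Real.pi / a)) * (n + θ - Complex.I * a * δ) ^ 2 *
      Complex.exp (-Real.pi / a * ((n : ℂ) + θ) ^ 2) := by
  have ha' : (a : ℂ) ≠ 0 := by exact_mod_cast ha.ne'
  have h := Real.tsum_eq_tsum_fourier_of_rpow_decay
    (f := fun t : ℝ => (2 * Real.pi * a * ((t : ℂ) - δ) ^ 2 - 1) *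
      Complex.exp (-Real.pi * a * t ^ 2 + 2 * Real.pi * (-Complex.I * θ) * t))
    (by fun_prop) one_lt_two ?_ ?_ 0
  · rw [fourier_quadratic_mul_gaussian ha] at h
    simpa using h
  · have hA : (-Real.pi * a : ℂ).re < 0 := by
      rw [show (-Real.pi * a : ℂ) = ((-(Real.pi * a) : ℝ) : ℂ) by push_cast; ring,
        Complex.ofReal_re]
      exact neg_neg_of_pos (mul_pos Real.pi_pos ha)
    refine (isBigO_quadratic_mul_cexp hA (2 * Real.pi * (-Complex.I * θ)) (2 * Real.pi * a)
      (-(4 * Real.pi * a * δ)) (2 * Real.pi * a * δ ^ 2 - 1)).congr_left fun t => ?_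
    ring
  · rw [fourier_quadratic_mul_gaussian ha]
    have hA : (-Real.pi / a : ℂ).re < 0 := by
      rw [show (-Real.pi / a : ℂ) = ((-(Real.pi / a) : ℝ) : ℂ) by push_cast; ring,
        Complex.ofReal_re]
      exact neg_neg_of_pos (div_pos Real.pi_pos ha)
    set K : ℂ := 1 / (√a : ℂ) * (-(2 * Real.pi / a)) * Complex.exp (-Real.pi / a * θ ^ 2)
    refine (isBigO_quadratic_mul_cexp hA (-2 * Real.pi / a * θ) K
      (2 * K * (θ - Complex.I * a * δ)) (K * (θ - Complex.I * a * δ) ^ 2)).congr_left fun t => ?_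
    have he : Complex.exp (-Real.pi / a * ((t : ℂ) + θ) ^ 2) = Complex.exp (-Real.pi / a * θ ^ 2)
        * Complex.exp (-Real.pi / a * t ^ 2 + -2 * Real.pi / a * θ * t) := by
      rw [← Complex.exp_add]; ring_nf
    rw [he]
    simp only [K]
    ring

/-! ### The theta kernel of weight two -/

/-- The coefficients of the theta kernel: the defect `∂² - 1` of `bdryTerm` along the flow. -/
noncomputable def kernelTerm (w v : ℝ) (p : ℤ × ℤ) : ℝ :=
  1 / √v * (2 * Real.pi * v * (latX w p - latY w p) ^ 2 - 1) * latGauss w v p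

/-- The theta series of the lattice of pairs `(b, c)` with quadratic form `-bc`, with a
quadratic Hermite polynomial factor that gives it weight two. -/
noncomputable def thetaKernel (w : ℝ) (τ : ℂ) : ℂ :=
  ∑' p, (kernelTerm w τ.im p : ℂ) * qChar p τ

lemma abs_kernelTerm_mul_norm_qChar_le {w W : ℝ} (hw : |w| ≤ W) (p : ℤ × ℤ)
    {τ : ℂ} (hτ : 0 < τ.im) :
    |kernelTerm w τ.im p| * ‖qChar p τ‖ ≤
      1 / √τ.im * (2 * Real.pi * τ.im * Real.exp W ^ 2 + 1) *
        ((1 + latSize p) ^ 2 * Real.exp (-(Real.pi * τ.im * Real.exp (-2 * W)) * latSize p)) := by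
  have hpi := Real.pi_pos
  have hs := latSize_nonneg p
  have h1 := latGauss_mul_norm_qChar_le hw hτ p le_rfl
  have h2 : |latX w p - latY w p| ≤ Real.exp W * (1 + latSize p) :=
    (abs_sub _ _).trans ((abs_latX_add_abs_latY_le hw p).trans (by gcongr; linarith))
  have h3 : |2 * Real.pi * τ.im * (latX w p - latY w p) ^ 2 - 1|
      ≤ (2 * Real.pi * τ.im * Real.exp W ^ 2 + 1) * (1 + latSize p) ^ 2 := by
    have h4 : (latX w p - latY w p) ^ 2 ≤ (Real.exp W * (1 + latSize p)) ^ 2 := by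
      rw [← sq_abs]; gcongr
    have h5 := mul_le_mul_of_nonneg_left h4 (by positivity : 0 ≤ 2 * Real.pi * τ.im)
    have h6 : 0 ≤ 2 * Real.pi * τ.im * (latX w p - latY w p) ^ 2 := by positivity
    rw [mul_pow] at h5
    rw [abs_le]
    constructor <;> nlinarith
  rw [kernelTerm, abs_mul, abs_mul, abs_of_pos (latGauss_pos _ _ _),
    abs_of_nonneg (by positivity : 0 ≤ 1 / √τ.im)]
  calc _ = 1 / √τ.im * |2 * Real.pi * τ.im * (latX w p - latY w p) ^ 2 - 1|
        * (latGauss w τ.im p * ‖qChar p τ‖) := by ring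
    _ ≤ 1 / √τ.im * ((2 * Real.pi * τ.im * Real.exp W ^ 2 + 1) * (1 + latSize p) ^ 2)
        * Real.exp (-(Real.pi * τ.im * Real.exp (-2 * W)) * latSize p) := by
      have := mul_nonneg (latGauss_pos w τ.im p).le (norm_nonneg (qChar p τ))
      gcongr
    _ = _ := by ring

lemma summable_kernelTerm (w : ℝ) {τ : ℂ} (hτ : 0 < τ.im) :
    Summable fun p => (kernelTerm w τ.im p : ℂ) * qChar p τ := by
  refine Summable.of_norm_bounded ((summable_majorant 2
    (β := Real.pi * τ.im * Real.exp (-2 * |w|)) (by have := Real.pi_pos; positivity)).mul_left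
    (1 / √τ.im * (2 * Real.pi * τ.im * Real.exp |w| ^ 2 + 1))) fun p => ?_
  rw [norm_mul, Complex.norm_real, Real.norm_eq_abs]
  exact abs_kernelTerm_mul_norm_qChar_le (le_refl |w|) p hτ

/-- The terms of the theta kernel after Poisson summation in the first lattice variable,
indexed by the pairs `(c, n)`. -/
noncomputable def dualTerm (w : ℝ) (τ : ℂ) (r : ℤ × ℤ) : ℂ :=
  (r.1 * (starRingEnd ℂ) τ + r.2) ^ 2 *
    Complex.exp (-Real.pi * Real.exp (2 * w) * (Complex.normSq (r.1 * τ + r.2) / τ.im : ℝ))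

lemma latSize_le_normSq {τ : ℂ} (hτ : 0 < τ.im) (r : ℤ × ℤ) :
    τ.im ^ 2 / (1 + 2 * τ.im ^ 2 + 2 * τ.re ^ 2) * latSize r ≤
      Complex.normSq (r.1 * τ + r.2) := by
  have h1 := abs_int_le_sq r.1
  have h2 := abs_int_le_sq r.2
  rw [div_mul_eq_mul_div, div_le_iff₀ (by positivity), Complex.normSq_apply, latSize]
  simp only [Complex.add_re, Complex.add_im, Complex.mul_re, Complex.mul_im, Complex.intCast_re,
    Complex.intCast_im, zero_mul, sub_zero, add_zero]
  generalize (r.1 : ℝ) = c at *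
  generalize (r.2 : ℝ) = n at *
  have h3 : τ.im ^ 2 * (|c| + |n|) ≤ τ.im ^ 2 * (c ^ 2 + n ^ 2) := by gcongr
  nlinarith [mul_nonneg (sq_nonneg τ.im) (sq_nonneg (2 * c * τ.re + n)),
    sq_nonneg (c * τ.im ^ 2), sq_nonneg (τ.re * (c * τ.re + n)), sq_nonneg (c * τ.re + n)]

lemma summable_dualTerm (w : ℝ) {τ : ℂ} (hτ : 0 < τ.im) : Summable (dualTerm w τ) := by
  have hpi := Real.pi_pos
  set κ := τ.im ^ 2 / (1 + 2 * τ.im ^ 2 + 2 * τ.re ^ 2) with hκ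
  have hκ0 : 0 < κ := by positivity
  refine Summable.of_norm_bounded ((summable_majorant 2
    (β := Real.pi * Real.exp (2 * w) * (κ / τ.im)) (by positivity)).mul_left ((1 + ‖τ‖) ^ 2))
    fun r => ?_
  have hs := latSize_nonneg r
  have h1 := latSize_le_normSq hτ r
  have hexp : (-Real.pi * Real.exp (2 * w) * (Complex.normSq (r.1 * τ + r.2) / τ.im : ℝ) : ℂ)
      = ((-(Real.pi * Real.exp (2 * w) * (Complex.normSq (r.1 * τ + r.2) / τ.im)) : ℝ) : ℂ) := by
    push_cast; ring
  have h2 : ‖(r.1 * (starRingEnd ℂ) τ + r.2 : ℂ)‖ ≤ (1 + ‖τ‖) * (1 + latSize r) := by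
    refine (norm_add_le _ _).trans ?_
    rw [norm_mul, RCLike.norm_conj, Complex.norm_intCast, Complex.norm_intCast, latSize]
    nlinarith [abs_nonneg (r.1 : ℝ), abs_nonneg (r.2 : ℝ), norm_nonneg τ,
      mul_nonneg (abs_nonneg (r.2 : ℝ)) (norm_nonneg τ)]
  rw [dualTerm, hexp, norm_mul, norm_pow, Complex.norm_exp_ofReal, ← mul_assoc, ← mul_pow]
  gcongr
  rw [neg_mul, neg_le_neg_iff, mul_assoc _ (κ / τ.im), div_mul_eq_mul_div]
  gcongr

/-- Poisson summation in the first lattice variable. -/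
lemma thetaKernel_eq_tsum_dualTerm (w : ℝ) {τ : ℂ} (hτ : 0 < τ.im) :
    thetaKernel w τ =
      ((-(2 * Real.pi * Real.exp w ^ 3) / τ.im ^ 2 : ℝ) : ℂ) * ∑' r, dualTerm w τ r := by
  have hq : 0 < √τ.im := Real.sqrt_pos.2 hτ
  have hqC : (√τ.im : ℂ) ≠ 0 := by exact_mod_cast hq.ne'
  have hv : (τ.im : ℂ) = (√τ.im : ℂ) ^ 2 := by exact_mod_cast (Real.sq_sqrt hτ.le).symm
  have heC : (Real.exp w : ℂ) ≠ 0 := by exact_mod_cast (Real.exp_pos w).ne'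
  have hF := summable_kernelTerm w hτ
  have hF' : Summable fun r : ℤ × ℤ => (kernelTerm w τ.im (Equiv.prodComm ℤ ℤ r) : ℂ)
      * qChar (Equiv.prodComm ℤ ℤ r) τ := (Equiv.prodComm ℤ ℤ).summable_iff.2 hF
  rw [thetaKernel, ← (Equiv.prodComm ℤ ℤ).tsum_eq, hF'.tsum_prod,
    (summable_dualTerm w hτ).tsum_prod, ← tsum_mul_left]
  refine tsum_congr fun c => ?_
  set a : ℝ := τ.im * Real.exp (-w) ^ 2 with ha_def
  have ha : 0 < a := by positivity
  have hsa : √a = √τ.im * (Real.exp w)⁻¹ := by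
    rw [ha_def, Real.sqrt_mul hτ.le, Real.sqrt_sq (Real.exp_pos _).le, Real.exp_neg]
  have haC : (a : ℂ) = (√τ.im : ℂ) ^ 2 * ((Real.exp w : ℂ)⁻¹) ^ 2 := by
    rw [ha_def, Real.exp_neg]; push_cast; rw [hv]
  have key := tsum_quadratic_mul_gaussian ha (τ.re * c) (c * Real.exp w ^ 2)
  set K : ℂ := 1 / (√τ.im : ℂ) * Complex.exp (-Real.pi * τ.im * (c * Real.exp w) ^ 2) with hK
  have hl (b : ℤ) : (kernelTerm w τ.im (b, c) : ℂ) * qChar (b, c) τ = K *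
      ((2 * Real.pi * a * ((b : ℂ) - (c * Real.exp w ^ 2 : ℝ)) ^ 2 - 1) *
      Complex.exp (-Real.pi * a * b ^ 2 + 2 * Real.pi * (-Complex.I * (τ.re * c : ℝ)) * b)) := by
    have e1 : (latGauss w τ.im (b, c) : ℂ) * qChar (b, c) τ =
        Complex.exp (-Real.pi * τ.im * (c * Real.exp w) ^ 2) *
        Complex.exp (-Real.pi * a * b ^ 2 + 2 * Real.pi * (-Complex.I * (τ.re * c : ℝ)) * b) := by
      rw [latGauss, qChar, Complex.ofReal_exp, ← Complex.exp_add, ← Complex.exp_add]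
      congr 1
      rw [latX, latY, Real.exp_neg, haC, ← hv]
      have hre := (Complex.re_add_im τ).symm
      push_cast
      field_simp
      linear_combination (-2 * (τ.im : ℂ) * b * c * (Complex.exp w) ^ 2) * Complex.I_sq
        + (-2 * Complex.I * b * c * (Complex.exp w) ^ 2) * hre
    have e2 : ((1 / √τ.im * (2 * Real.pi * τ.im * (latX w (b, c) - latY w (b, c)) ^ 2 - 1) : ℝ) : ℂ)
        = 1 / (√τ.im : ℂ) *
          (2 * Real.pi * a * ((b : ℂ) - (c * Real.exp w ^ 2 : ℝ)) ^ 2 - 1) := by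
      rw [latX, latY, Real.exp_neg, haC, ← hv]
      push_cast [-Complex.ofReal_exp]
      field_simp
    rw [kernelTerm, Complex.ofReal_mul, mul_assoc, e1, e2, hK]
    ring
  have hr (n : ℤ) : ((-(2 * Real.pi * Real.exp w ^ 3) / τ.im ^ 2 : ℝ) : ℂ) * dualTerm w τ (c, n)
      = K * (1 / (√a : ℂ) * (-(2 * Real.pi / a)) *
        (n + (τ.re * c : ℝ) - Complex.I * a * (c * Real.exp w ^ 2 : ℝ)) ^ 2 *
      Complex.exp (-Real.pi / a * ((n : ℂ) + (τ.re * c : ℝ)) ^ 2)) := by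
    have e1 : Complex.exp (-Real.pi * τ.im * (c * Real.exp w) ^ 2) *
        Complex.exp (-Real.pi / a * ((n : ℂ) + (τ.re * c : ℝ)) ^ 2) =
        Complex.exp (-Real.pi * Real.exp (2 * w) * (Complex.normSq (c * τ + n) / τ.im : ℝ)) := by
      rw [← Complex.exp_add]
      congr 1
      have hN : Complex.normSq (c * τ + n) = (n + τ.re * c) ^ 2 + (c * τ.im) ^ 2 := by
        rw [Complex.normSq_apply]
        simp only [Complex.add_re, Complex.add_im, Complex.mul_re, Complex.mul_im,
          Complex.intCast_re, Complex.intCast_im, zero_mul, sub_zero, add_zero]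
        ring
      have h2w : Real.exp (2 * w) = Real.exp w ^ 2 := by rw [← Real.exp_nat_mul]; norm_num
      rw [hN, h2w, haC]
      push_cast [-Complex.ofReal_exp]
      rw [hv]
      field_simp
      ring
    have e2 : (n + (τ.re * c : ℝ) - Complex.I * a * (c * Real.exp w ^ 2 : ℝ) : ℂ)
        = c * (starRingEnd ℂ) τ + n := by
      have hconj : (starRingEnd ℂ) τ = τ.re - τ.im * Complex.I := by
        apply Complex.ext <;> simp
      rw [hconj, haC, ← hv]
      push_cast [-Complex.ofReal_exp]
      field_simp
      ring
    rw [e2, dualTerm, ← e1, hK, hsa, haC]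
    push_cast [-Complex.ofReal_exp]
    rw [hv]
    field_simp
  simp only [Equiv.prodComm_apply, Prod.swap_prod_mk]
  rw [tsum_congr hl, tsum_mul_left, key, ← tsum_mul_left, ← tsum_mul_left]
  exact tsum_congr fun n => (hr n).symm

/-- Right multiplication of the row vector `(c, n)` by a matrix in `SL₂(ℤ)`. -/
def rowEquiv (γ : SL(2, ℤ)) : ℤ × ℤ ≃ ℤ × ℤ where
  toFun r := (r.1 * γ 0 0 + r.2 * γ 1 0, r.1 * γ 0 1 + r.2 * γ 1 1)
  invFun r := (r.1 * γ 1 1 - r.2 * γ 1 0, -r.1 * γ 0 1 + r.2 * γ 0 0)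
  left_inv r := by
    have h := γ.det_coe
    rw [Matrix.det_fin_two] at h
    ext
    · linear_combination r.1 * h
    · linear_combination r.2 * h
  right_inv r := by
    have h := γ.det_coe
    rw [Matrix.det_fin_two] at h
    ext
    · linear_combination r.1 * h
    · linear_combination r.2 * h

/-- The theta kernel has weight two. -/
lemma thetaKernel_smul (w : ℝ) (γ : SL(2, ℤ)) (τ : ℍ) :
    thetaKernel w (γ • τ : ℍ) = denom γ τ ^ 2 * thetaKernel w τ := by
  have hD := denom_ne_zero γ τ
  set D : ℂ := denom γ τ with hD_def
  have hDc : (starRingEnd ℂ) D ≠ 0 := by simpa using hD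
  have hD' : D = γ 1 0 * τ + γ 1 1 := ModularGroup.denom_apply γ τ
  have him : ((γ • τ : ℍ) : ℂ).im = (τ : ℂ).im / Complex.normSq D :=
    ModularGroup.im_smul_eq_div_normSq γ τ
  have hN : Complex.normSq D ≠ 0 := by simpa using hD
  have hNC : (Complex.normSq D : ℂ) = (starRingEnd ℂ) D * D := Complex.normSq_eq_conj_mul_self
  have hτ : (τ : ℂ).im ≠ 0 := τ.im_pos.ne'
  have hτC : ((τ : ℂ).im : ℂ) ≠ 0 := by exact_mod_cast hτ
  have hform (r : ℤ × ℤ) : (r.1 * ((γ • τ : ℍ) : ℂ) + r.2)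
      = ((rowEquiv γ r).1 * τ + (rowEquiv γ r).2) / D := by
    rw [coe_specialLinearGroup_apply, eq_div_iff hD]
    have hD2 : ((algebraMap ℤ ℝ (γ 1 0) : ℂ) * τ + (algebraMap ℤ ℝ (γ 1 1) : ℂ)) = D := by
      rw [hD']; simp
    rw [hD2]
    simp only [rowEquiv, Equiv.coe_fn_mk, algebraMap_int_eq, eq_intCast, Complex.ofReal_intCast]
    field_simp
    rw [hD']
    push_cast
    ring
  have hterm (r : ℤ × ℤ) : dualTerm w (γ • τ : ℍ) r
      = 1 / (starRingEnd ℂ) D ^ 2 * dualTerm w τ (rowEquiv γ r) := by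
    have hc : (r.1 * (starRingEnd ℂ) ((γ • τ : ℍ) : ℂ) + r.2)
        = ((rowEquiv γ r).1 * (starRingEnd ℂ) (τ : ℂ) + (rowEquiv γ r).2) / (starRingEnd ℂ) D := by
      have := congrArg (starRingEnd ℂ) (hform r)
      simpa using this
    rw [dualTerm, dualTerm, hc, hform, him, map_div₀, div_div_div_cancel_right₀ hN]
    ring
  rw [thetaKernel_eq_tsum_dualTerm w (γ • τ : ℍ).im_pos, thetaKernel_eq_tsum_dualTerm w τ.im_pos,
    tsum_congr hterm, tsum_mul_left, (rowEquiv γ).tsum_eq (dualTerm w τ), him]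
  push_cast
  rw [hNC]
  field_simp

/-! ### The differential equation in the second variable -/

/-- A bounded solution of `u'' = u` on the real line vanishes. -/
lemma eq_zero_of_hasDerivAt_of_bounded {u u' : ℝ → ℂ} (h : ∀ w, HasDerivAt u (u' w) w)
    (h' : ∀ w, HasDerivAt u' (u w) w) {C : ℝ} (hC : ∀ w, ‖u w‖ ≤ C) (w : ℝ) : u w = 0 := by
  have hexp (x : ℝ) : HasDerivAt (fun x : ℝ => (Real.exp x : ℂ)) (Real.exp x : ℂ) x :=
    (Real.hasDerivAt_exp x).ofReal_comp
  have hexpn (x : ℝ) : HasDerivAt (fun x : ℝ => (Real.exp (-x) : ℂ)) (-(Real.exp (-x) : ℂ)) x := by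
    have := ((hasDerivAt_neg x).exp).ofReal_comp
    convert! this using 1
    push_cast
    ring
  -- the two constants of integration
  have hP (x : ℝ) : (u' x + u x) * (Real.exp (-x) : ℂ) = u' 0 + u 0 := by
    have := is_const_of_deriv_eq_zero (f := fun x => (u' x + u x) * (Real.exp (-x) : ℂ))
      (fun y => (((h' y).add (h y)).mul (hexpn y)).differentiableAt)
      (fun y => by
        refine (((h' y).add (h y)).mul (hexpn y)).deriv.trans ?_
        simp only [Pi.add_apply]
        ring) x 0
    simpa using this
  have hQ (x : ℝ) : (u' x - u x) * (Real.exp x : ℂ) = u' 0 - u 0 := by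
    have := is_const_of_deriv_eq_zero (f := fun x => (u' x - u x) * (Real.exp x : ℂ))
      (fun y => (((h' y).sub (h y)).mul (hexp y)).differentiableAt)
      (fun y => by
        refine (((h' y).sub (h y)).mul (hexp y)).deriv.trans ?_
        simp only [Pi.sub_apply]
        ring) x 0
    simpa using this
  have hee (x : ℝ) : (Real.exp (-x) : ℂ) * (Real.exp x : ℂ) = 1 := by
    rw [← Complex.ofReal_mul, ← Real.exp_add]
    simp
  have hu (x : ℝ) : 2 * u x = (u' 0 + u 0) * (Real.exp x : ℂ)
      - (u' 0 - u 0) * (Real.exp (-x) : ℂ) := by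
    rw [← hP x, ← hQ x]
    linear_combination (-2 * u x) * hee x
  have hle (c : ℂ) (D : ℝ) (hD : ∀ x : ℝ, 0 ≤ x → ‖c‖ * Real.exp x ≤ D) : c = 0 := by
    by_contra hc
    obtain ⟨x, hx, hx0⟩ := (((Real.tendsto_exp_atTop.const_mul_atTop
      (norm_pos_iff.2 hc)).eventually_gt_atTop D).and (eventually_ge_atTop 0)).exists
    exact (hD x hx0).not_gt hx
  have hone (x : ℝ) (hx : 0 ≤ x) : ‖(Real.exp (-x) : ℂ)‖ ≤ 1 := by
    rw [Complex.norm_real, Real.norm_of_nonneg (Real.exp_pos _).le]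
    exact Real.exp_le_one_iff.2 (by linarith)
  have hP0 : u' 0 + u 0 = 0 := by
    refine hle _ (2 * C + ‖u' 0 - u 0‖) fun x hx => ?_
    have e : (u' 0 + u 0) * (Real.exp x : ℂ) = 2 * u x + (u' 0 - u 0) * (Real.exp (-x) : ℂ) := by
      rw [hu]; ring
    have := congrArg norm e
    rw [norm_mul, Complex.norm_real, Real.norm_of_nonneg (Real.exp_pos _).le] at this
    rw [this]
    refine (norm_add_le _ _).trans ?_
    rw [norm_mul, norm_mul, Complex.norm_two]
    gcongr
    · exact hC x
    · exact mul_le_of_le_one_right (norm_nonneg _) (hone x hx)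
  have hQ0 : u' 0 - u 0 = 0 := by
    refine hle _ (2 * C + ‖u' 0 + u 0‖) fun x hx => ?_
    have e : (u' 0 - u 0) * (Real.exp x : ℂ)
        = (u' 0 + u 0) * (Real.exp (-x) : ℂ) - 2 * u (-x) := by
      rw [hu, neg_neg]; ring
    have := congrArg norm e
    rw [norm_mul, Complex.norm_real, Real.norm_of_nonneg (Real.exp_pos _).le] at this
    rw [this]
    refine (norm_sub_le _ _).trans ?_
    rw [norm_mul, norm_mul, Complex.norm_two, add_comm]
    gcongr
    · exact hC (-x)
    · exact mul_le_of_le_one_right (norm_nonneg _) (hone x hx)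
  have := hu w
  rw [hP0, hQ0] at this
  simpa using this

/-- The corrected generating series divided by `t`, with `s = exp w`. -/
noncomputable def bdrySeries (w : ℝ) (τ : ℂ) : ℂ :=
  latSeries (fun p v => (bdryTerm v (latX w p) (latY w p) : ℂ)) τ
    - ((1 / (2 * τ.im) * (Real.exp w + Real.exp (-w)) : ℝ) : ℂ)

/-- The derivative of `bdrySeries` in `w`. -/
noncomputable def bdrySeriesFlow (w : ℝ) (τ : ℂ) : ℂ :=
  latSeries (fun p v => (bdryTermFlow v (latX w p) (latY w p) : ℂ)) τ
    - ((1 / (2 * τ.im) * (Real.exp w - Real.exp (-w)) : ℝ) : ℂ)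

lemma summable_bdryTerm (w : ℝ) {τ : ℂ} (hτ : 0 < τ.im) :
    Summable fun p => (bdryTerm τ.im (latX w p) (latY w p) : ℂ) * qChar p τ :=
  (isAdmissible_bdryTerm w).summable hτ

lemma summable_bdryTermFlow (w : ℝ) {τ : ℂ} (hτ : 0 < τ.im) :
    Summable fun p => (bdryTermFlow τ.im (latX w p) (latY w p) : ℂ) * qChar p τ := by
  refine Summable.of_norm_bounded ((summable_majorant 1
    (β := Real.pi * τ.im * Real.exp (-2 * |w|)) (by have := Real.pi_pos; positivity)).mul_left
    (1 / √τ.im + 2 * Real.pi * Real.exp |w|)) fun p => ?_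
  rw [norm_mul, Complex.norm_real, Real.norm_eq_abs]
  exact abs_bdryTermFlow_mul_norm_qChar_le (le_refl |w|) hτ p le_rfl

lemma hasDerivAt_exp_add_exp_neg (a w : ℝ) :
    HasDerivAt (fun w => ((a * (Real.exp w + Real.exp (-w)) : ℝ) : ℂ))
      ((a * (Real.exp w - Real.exp (-w)) : ℝ) : ℂ) w := by
  have := (((Real.hasDerivAt_exp w).add (hasDerivAt_neg w).exp).const_mul a).ofReal_comp
  convert! this using 1
  push_cast
  ring

lemma hasDerivAt_exp_sub_exp_neg (a w : ℝ) :
    HasDerivAt (fun w => ((a * (Real.exp w - Real.exp (-w)) : ℝ) : ℂ))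
      ((a * (Real.exp w + Real.exp (-w)) : ℝ) : ℂ) w := by
  have := (((Real.hasDerivAt_exp w).sub (hasDerivAt_neg w).exp).const_mul a).ofReal_comp
  convert! this using 1
  push_cast
  ring

lemma hasDerivAt_bdrySeries (w : ℝ) {τ : ℂ} (hτ : 0 < τ.im) :
    HasDerivAt (fun w => bdrySeries w τ) (bdrySeriesFlow w τ) w := by
  refine HasDerivAt.sub ?_ (hasDerivAt_exp_add_exp_neg _ w)
  have hw : w ∈ Set.Ioo (-(|w| + 1)) (|w| + 1) := abs_lt.1 (lt_add_one _)
  refine hasDerivAt_tsum_of_isPreconnected ((summable_majorant 1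
    (β := Real.pi * τ.im * Real.exp (-2 * (|w| + 1)))
    (by have := Real.pi_pos; positivity)).mul_left
    (1 / √τ.im + 2 * Real.pi * Real.exp (|w| + 1))) isOpen_Ioo isPreconnected_Ioo
    (fun p x _ => ((hasDerivAt_bdryTerm_flow hτ x p).ofReal_comp).mul_const _)
    (fun p x hx => ?_) hw (summable_bdryTerm w hτ) hw
  rw [norm_mul, Complex.norm_real, Real.norm_eq_abs]
  exact abs_bdryTermFlow_mul_norm_qChar_le (abs_lt.2 hx).le hτ p le_rfl

/-- The series solves `u'' - u = thetaKernel`. The linear correction term lies in the kernel of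
the operator. -/
lemma hasDerivAt_bdrySeriesFlow (w : ℝ) {τ : ℂ} (hτ : 0 < τ.im) :
    HasDerivAt (fun w => bdrySeriesFlow w τ) (bdrySeries w τ + thetaKernel w τ) w := by
  have hw : w ∈ Set.Ioo (-(|w| + 1)) (|w| + 1) := abs_lt.1 (lt_add_one _)
  have h := hasDerivAt_tsum_of_isPreconnected
    (g := fun p w => (bdryTermFlow τ.im (latX w p) (latY w p) : ℂ) * qChar p τ)
    (g' := fun p w => ((bdryTerm τ.im (latX w p) (latY w p) + kernelTerm w τ.im p : ℝ) : ℂ)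
      * qChar p τ)
    (((summable_majorant 1 (β := Real.pi * τ.im * Real.exp (-2 * (|w| + 1)))
      (by have := Real.pi_pos; positivity)).mul_left
      (1 / √τ.im + 2 * Real.pi * Real.exp (|w| + 1))).add
    ((summable_majorant 2 (β := Real.pi * τ.im * Real.exp (-2 * (|w| + 1)))
      (by have := Real.pi_pos; positivity)).mul_left
      (1 / √τ.im * (2 * Real.pi * τ.im * Real.exp (|w| + 1) ^ 2 + 1))))
    isOpen_Ioo isPreconnected_Ioo
    (fun p x _ => ((hasDerivAt_bdryTermFlow_flow hτ x p).ofReal_comp).mul_const _)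
    (fun p x hx => ?_) hw (summable_bdryTermFlow w hτ) hw
  · refine (h.sub (hasDerivAt_exp_sub_exp_neg (1 / (2 * τ.im)) w)).congr_deriv ?_
    simp only [Complex.ofReal_add, add_mul]
    rw [(summable_bdryTerm w hτ).tsum_add (summable_kernelTerm w hτ), bdrySeries, thetaKernel,
      latSeries]
    push_cast
    ring
  · rw [Complex.ofReal_add, add_mul]
    refine (norm_add_le _ _).trans (add_le_add ?_ ?_)
    · rw [norm_mul, Complex.norm_real, Real.norm_eq_abs]
      exact abs_bdryTerm_mul_norm_qChar_le (abs_lt.2 hx).le hτ p le_rfl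
    · rw [norm_mul, Complex.norm_real, Real.norm_eq_abs]
      exact abs_kernelTerm_mul_norm_qChar_le (abs_lt.2 hx).le p hτ

/-! ### Boundedness in the second variable -/

/-- A bound off the coordinate axes that does not depend on `w`. -/
lemma abs_bdryTerm_mul_norm_qChar_le_of_ne_zero (w : ℝ) {p : ℤ × ℤ} (hp : p.1 * p.2 ≠ 0)
    {τ : ℂ} (hτ : 0 < τ.im) :
    |bdryTerm τ.im (latX w p) (latY w p)| * ‖qChar p τ‖ ≤
      (1 / √τ.im + 2 * Real.pi) *
        ((1 + latSize p) ^ 2 * Real.exp (-(Real.pi * τ.im) * latSize p)) := by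
  have hpi := Real.pi_pos
  have hs := latSize_nonneg p
  have h1 := latSize_le_two_mul_abs hp
  have h0 : 0 ≤ 1 / √τ.im := by positivity
  have h2 : |(p.1 : ℝ) * p.2| ≤ (1 + latSize p) ^ 2 := by
    rw [abs_mul, latSize]
    nlinarith [abs_nonneg (p.1 : ℝ), abs_nonneg (p.2 : ℝ)]
  have hone : 1 ≤ |latX w p * latY w p| := by
    rw [latX_mul_latY]
    exact_mod_cast Int.one_le_abs hp
  have h3 : |bdryTerm τ.im (latX w p) (latY w p)| * ‖qChar p τ‖ ≤
      (1 / √τ.im + 2 * Real.pi * |(p.1 : ℝ) * p.2|) *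
        Real.exp (-(2 * Real.pi * τ.im * |(p.1 : ℝ) * p.2|)) := by
    rcases hp.lt_or_gt with h | h
    · have hb := abs_bdryTerm_le_mul hτ hone
      rw [latX_mul_latY] at hb
      have hq : ‖qChar p τ‖ = Real.exp (-(2 * Real.pi * τ.im * |(p.1 : ℝ) * p.2|)) := by
        rw [norm_qChar, abs_of_neg (by exact_mod_cast h)]
        ring_nf
      rw [hq]
      gcongr
    · have h' : (0 : ℝ) < p.1 * p.2 := by exact_mod_cast h
      have hb := abs_bdryTerm_le_gauss hτ (x := latX w p) (y := latY w p)
        (by rw [latX_mul_latY]; exact h'.le)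
      calc _ ≤ 1 / √τ.im * latGauss w τ.im p * ‖qChar p τ‖ := by
            rw [latGauss]; gcongr
        _ = 1 / √τ.im * (latGauss w τ.im p * ‖qChar p τ‖) := by ring
        _ ≤ _ := by
          rw [latGauss_mul_norm_qChar]
          gcongr
          · have : 0 ≤ 2 * Real.pi * |(p.1 : ℝ) * p.2| := by positivity
            linarith
          · rw [abs_of_pos h', ← latX_mul_latY w]
            have := mul_nonneg (mul_pos hpi hτ).le (sq_nonneg (latX w p - latY w p))
            nlinarith
  refine h3.trans ?_
  rw [← mul_assoc]
  gcongr ?_ * Real.exp ?_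
  · have : 1 ≤ (1 + latSize p) ^ 2 := one_le_pow₀ (by linarith)
    rw [add_mul]
    gcongr
    exact le_mul_of_one_le_right h0 this
  · have := mul_le_mul_of_nonneg_left h1 (mul_pos hpi hτ).le
    linarith

lemma bdryTerm_zero_right {v : ℝ} (hv : 0 < v) (x : ℝ) :
    bdryTerm v x 0 = (softAbs (√v * x) - Real.pi * |√v * x|) / √v := by
  rw [bdryTerm_eq hv]
  simp

lemma bdryTerm_comm (v x y : ℝ) : bdryTerm v x y = bdryTerm v y x := by
  rw [bdryTerm, bdryTerm, add_comm x y]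
  ring

/-- The sum over one coordinate axis equals `s / (2v)` up to a bounded error. -/
lemma abs_tsum_bdryTerm_axis_le {v : ℝ} (hv : 0 < v) (w : ℝ) :
    Summable (fun n : ℤ => bdryTerm v (n * Real.exp (-w)) 0) ∧
      |∑' n : ℤ, bdryTerm v (n * Real.exp (-w)) 0 - 1 / (2 * v) * Real.exp w| ≤ 3 / √v := by
  have hq : 0 < √v := Real.sqrt_pos.2 hv
  have ha : 0 < √v * Real.exp (-w) := by positivity
  have he (n : ℤ) : bdryTerm v (n * Real.exp (-w)) 0 =
      (softAbs (n * (√v * Real.exp (-w))) - Real.pi * |n * (√v * Real.exp (-w))|) / √v := by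
    rw [bdryTerm_zero_right hv, mul_left_comm]
  have hlim : 1 / (2 * v) * Real.exp w = 1 / (2 * (√v * Real.exp (-w))) / √v := by
    have hv2 : v = √v ^ 2 := (Real.sq_sqrt hv.le).symm
    rw [Real.exp_neg]
    nth_rewrite 1 [hv2]
    field_simp
  simp only [he]
  refine ⟨(summable_int_softAbs_sub ha).div_const _, ?_⟩
  rw [tsum_div_const, hlim, ← sub_div, abs_div, abs_of_pos hq]
  gcongr
  exact abs_tsum_int_softAbs_sub_le ha

lemma qChar_of_mul_eq_zero {p : ℤ × ℤ} (hp : p.1 * p.2 = 0) (τ : ℂ) : qChar p τ = 1 := by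
  have : (p.1 * p.2 : ℂ) = 0 := by exact_mod_cast hp
  simp [qChar, this]

lemma exists_norm_bdrySeries_le {τ : ℂ} (hτ : 0 < τ.im) : ∃ C, ∀ w, ‖bdrySeries w τ‖ ≤ C := by
  have hpi := Real.pi_pos
  have hmaj := (summable_majorant 2 (β := Real.pi * τ.im) (by positivity)).mul_left
    (1 / √τ.im + 2 * Real.pi)
  have hmaj0 (p : ℤ × ℤ) : 0 ≤ (1 / √τ.im + 2 * Real.pi) *
      ((1 + latSize p) ^ 2 * Real.exp (-(Real.pi * τ.im) * latSize p)) := by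
    have := latSize_nonneg p; positivity
  refine ⟨(∑' p, (1 / √τ.im + 2 * Real.pi) *
      ((1 + latSize p) ^ 2 * Real.exp (-(Real.pi * τ.im) * latSize p)))
    + (3 / √τ.im + 3 / √τ.im + 1 / √τ.im), fun w => ?_⟩
  set off : ℤ × ℤ → ℂ := fun p => if p.1 * p.2 = 0 then 0 else
    (bdryTerm τ.im (latX w p) (latY w p) : ℂ) * qChar p τ with hoff
  set A : ℤ × ℤ → ℝ := fun p => if p.2 = 0 then bdryTerm τ.im (p.1 * Real.exp (-w)) 0 else 0
    with hA
  set B : ℤ × ℤ → ℝ := fun p => if p.1 = 0 then bdryTerm τ.im (p.2 * Real.exp (-(-w))) 0 else 0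
    with hB
  set Z : ℤ × ℤ → ℝ := fun p => if p = 0 then 1 / √τ.im else 0 with hZ
  -- inclusion and exclusion on the two axes
  have hsplit (p : ℤ × ℤ) : (bdryTerm τ.im (latX w p) (latY w p) : ℂ) * qChar p τ
      = off p + ((A p + B p - Z p : ℝ) : ℂ) := by
    obtain ⟨b, c⟩ := p
    by_cases hb : b = 0 <;> by_cases hc : c = 0
    · subst hb hc
      rw [qChar_of_mul_eq_zero (by simp)]
      simp [hoff, hA, hB, hZ, latX, latY, bdryTerm, softAbs_zero]
    · subst hb
      rw [qChar_of_mul_eq_zero (by simp)]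
      simp [hoff, hA, hB, hZ, latX, latY, hc, bdryTerm_comm τ.im 0]
    · subst hc
      rw [qChar_of_mul_eq_zero (by simp)]
      simp [hoff, hA, hB, hZ, latX, latY, hb]
    · simp [hoff, hA, hB, hZ, hb, hc]
  have hoff_le (p : ℤ × ℤ) : ‖off p‖ ≤ (1 / √τ.im + 2 * Real.pi) *
      ((1 + latSize p) ^ 2 * Real.exp (-(Real.pi * τ.im) * latSize p)) := by
    by_cases hp : p.1 * p.2 = 0
    · simp only [hoff, if_pos hp, norm_zero]
      exact hmaj0 p
    · simp only [hoff, if_neg hp]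
      rw [norm_mul, Complex.norm_real, Real.norm_eq_abs]
      exact abs_bdryTerm_mul_norm_qChar_le_of_ne_zero w hp hτ
  have hoff_sum : Summable off := Summable.of_norm_bounded hmaj hoff_le
  obtain ⟨hα, hα'⟩ := abs_tsum_bdryTerm_axis_le hτ w
  obtain ⟨hβ, hβ'⟩ := abs_tsum_bdryTerm_axis_le hτ (-w)
  have hAs : HasSum A (∑' n : ℤ, bdryTerm τ.im (n * Real.exp (-w)) 0) := by
    have hinj : Function.Injective fun n : ℤ => ((n, 0) : ℤ × ℤ) := fun a b h => by simpa using h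
    refine (hinj.hasSum_iff fun p hp => ?_).1 (by simpa [hA, Function.comp_def] using hα.hasSum)
    have : p.2 ≠ 0 := fun h => hp ⟨p.1, by rw [← h]⟩
    simp [hA, this]
  have hBs : HasSum B (∑' n : ℤ, bdryTerm τ.im (n * Real.exp (-(-w))) 0) := by
    have hinj : Function.Injective fun n : ℤ => ((0, n) : ℤ × ℤ) := fun a b h => by simpa using h
    refine (hinj.hasSum_iff fun p hp => ?_).1 (by simpa [hB, Function.comp_def] using hβ.hasSum)
    have : p.1 ≠ 0 := fun h => hp ⟨p.2, by rw [← h]⟩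
    simp [hB, this]
  have hZs : HasSum Z (1 / √τ.im) := by
    have := hasSum_ite_eq (0 : ℤ × ℤ) (1 / √τ.im)
    simpa [hZ] using this
  have htot := hoff_sum.hasSum.add (Complex.hasSum_ofReal.2 ((hAs.add hBs).sub hZs))
  have hval : bdrySeries w τ = (∑' p, off p) +
      (((∑' n : ℤ, bdryTerm τ.im (n * Real.exp (-w)) 0 - 1 / (2 * τ.im) * Real.exp w)
      + (∑' n : ℤ, bdryTerm τ.im (n * Real.exp (-(-w))) 0 - 1 / (2 * τ.im) * Real.exp (-w))
      - 1 / √τ.im : ℝ) : ℂ) := by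
    rw [bdrySeries, latSeries, tsum_congr hsplit, htot.tsum_eq]
    push_cast
    ring
  rw [hval]
  refine (norm_add_le _ _).trans (add_le_add (tsum_of_norm_bounded hmaj.hasSum hoff_le) ?_)
  rw [Complex.norm_real, Real.norm_eq_abs]
  refine (abs_sub _ _).trans (add_le_add ((abs_add_le _ _).trans (add_le_add hα' hβ')) ?_)
  rw [abs_of_nonneg (by positivity)]

/-- The difference of the two sides is a bounded solution of `u'' = u` in `w`, because the theta
kernel has weight two. -/
lemma bdrySeries_smul (w : ℝ) (γ : SL(2, ℤ)) (τ : ℍ) :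
    bdrySeries w (γ • τ : ℍ) = denom γ τ ^ 2 * bdrySeries w τ := by
  obtain ⟨C₁, hC₁⟩ := exists_norm_bdrySeries_le (γ • τ : ℍ).im_pos
  obtain ⟨C₂, hC₂⟩ := exists_norm_bdrySeries_le τ.im_pos
  refine sub_eq_zero.1 (eq_zero_of_hasDerivAt_of_bounded
    (u := fun w => bdrySeries w (γ • τ : ℍ) - denom γ τ ^ 2 * bdrySeries w τ)
    (u' := fun w => bdrySeriesFlow w (γ • τ : ℍ) - denom γ τ ^ 2 * bdrySeriesFlow w τ)
    (C := C₁ + ‖denom γ τ ^ 2‖ * C₂)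
    (fun w => (hasDerivAt_bdrySeries w (γ • τ : ℍ).im_pos).sub
      ((hasDerivAt_bdrySeries w τ.im_pos).const_mul _)) (fun w => ?_) (fun w => ?_) w)
  · refine ((hasDerivAt_bdrySeriesFlow w (γ • τ : ℍ).im_pos).sub
      ((hasDerivAt_bdrySeriesFlow w τ.im_pos).const_mul _)).congr_deriv ?_
    rw [thetaKernel_smul]
    ring
  · refine (norm_sub_le _ _).trans (add_le_add (hC₁ w) ?_)
    rw [norm_mul]
    exact mul_le_mul_of_nonneg_left (hC₂ w) (norm_nonneg _)

/-! ### Analytic properties in the modular variable -/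

lemma contDiffOn_bdrySeries (w : ℝ) : ContDiffOn ℝ ∞ (bdrySeries w) {τ | 0 < τ.im} := by
  refine contDiffOn_infty.2 fun n => ContDiffOn.sub ?_ ?_
  · simpa only [one_mul] using contDiffOn_latSeries_bdryTerm w n (isPolyBounded_const 1)
  · have him : ContDiffOn ℝ n Complex.im {τ | 0 < τ.im} := Complex.imCLM.contDiff.contDiffOn
    refine Complex.ofRealCLM.contDiff.comp_contDiffOn (ContDiffOn.mul (ContDiffOn.div
      contDiffOn_const (contDiffOn_const.mul him) fun τ hτ => ?_) contDiffOn_const)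
    have : 0 < τ.im := hτ
    positivity

/-- The differential of the series: the coefficient of `dv` is a multiple of a Siegel theta
function plus the contribution of the correction term. -/
lemma hasFDerivAt_bdrySeries (w : ℝ) {τ : ℂ} (hτ : 0 < τ.im) :
    ∃ A : ℂ, HasFDerivAt (bdrySeries w) (A • ContinuousLinearMap.id ℝ ℂ
      + (((-(1 / (2 * τ.im * √τ.im)) : ℝ) : ℂ) * latSeries (fun p v => latGauss w v p) τ
        + ((1 / (2 * τ.im ^ 2) * (Real.exp w + Real.exp (-w)) : ℝ) : ℂ)) • imC) τ := by
  have h1 := hasFDerivAt_latSeries_bdryTerm w (isPolyBounded_const 1) hτ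
  simp only [one_mul] at h1
  have hd : HasDerivAt (fun v : ℝ => 1 / (2 * v) * (Real.exp w + Real.exp (-w)))
      (-(1 / (2 * τ.im ^ 2) * (Real.exp w + Real.exp (-w)))) τ.im := by
    have := ((((hasDerivAt_id τ.im).const_mul 2).inv (by simpa using hτ.ne')).mul_const
      (Real.exp w + Real.exp (-w)))
    simp only [one_div]
    convert! this using 1
    simp only [id]
    field_simp
  have h2 : HasFDerivAt (fun z : ℂ => ((1 / (2 * z.im) * (Real.exp w + Real.exp (-w)) : ℝ) : ℂ))
      ((-(1 / (2 * τ.im ^ 2) * (Real.exp w + Real.exp (-w))) : ℝ) • imC) τ := by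
    refine (Complex.ofRealCLM.hasFDerivAt.comp τ
      (hd.comp_hasFDerivAt τ Complex.imCLM.hasFDerivAt)).congr_fderiv ?_
    ext
    simp [imC]
  refine ⟨latSeries (fun p v => -(2 * Real.pi * Complex.I) * (p.1 * p.2) * 1
    * bdryTerm v (latX w p) (latY w p)) τ, (h1.sub h2).congr_fderiv ?_⟩
  ext
  simp [imC]
  ring

/-- On the imaginary axis the Siegel theta function is at least its constant term. -/
lemma one_le_re_latSeries_latGauss (w : ℝ) {v : ℝ} (hv : 0 < v) :
    1 ≤ (latSeries (fun p v => latGauss w v p) (v * Complex.I)).re := by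
  have him : ((v : ℂ) * Complex.I).im = v := by simp
  have hterm (p : ℤ × ℤ) : (latGauss w ((v : ℂ) * Complex.I).im p : ℂ) * qChar p (v * Complex.I)
      = ((latGauss w v p * Real.exp (2 * Real.pi * v * (p.1 * p.2)) : ℝ) : ℂ) := by
    rw [him, qChar]
    push_cast
    congr 2
    linear_combination (-(2 * Real.pi * (p.1 * p.2) * v)) * Complex.I_sq
  have hs := (isAdmissible_latGauss w).summable (τ := v * Complex.I) (by simpa using hv)
  have hs' : Summable fun p : ℤ × ℤ =>
      latGauss w v p * Real.exp (2 * Real.pi * v * (p.1 * p.2)) :=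
    Complex.summable_ofReal.1 (hs.congr hterm)
  rw [latSeries, tsum_congr hterm, ← Complex.ofReal_tsum, Complex.ofReal_re]
  have := hs'.le_tsum (0 : ℤ × ℤ) fun p _ =>
    mul_nonneg (latGauss_pos w v p).le (Real.exp_pos _).le
  simpa [latGauss, latX, latY] using this

/-- If the series were holomorphic, the coefficient of `dv` would vanish on the imaginary axis,
forcing `√v ≤ s + 1 / s` for all `v`. -/
lemma not_differentiableOn_bdrySeries (w : ℝ) :
    ¬ DifferentiableOn ℂ (bdrySeries w) {τ | 0 < τ.im} := by
  intro hdiff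
  set S := Real.exp w + Real.exp (-w) with hS
  have hS0 : 0 < S := by positivity
  have hv : 0 < (S + 1) ^ 2 := by positivity
  set v := (S + 1) ^ 2 with hv_def
  have hsq : √v = S + 1 := Real.sqrt_sq (by linarith)
  have him : ((v : ℂ) * Complex.I).im = v := by simp
  have hτ : 0 < ((v : ℂ) * Complex.I).im := by rwa [him]
  obtain ⟨A, hA⟩ := hasFDerivAt_bdrySeries w hτ
  have hC := ((hdiff.differentiableAt (isOpen_upperHalf.mem_nhds hτ)).hasDerivAt.hasFDerivAt
    ).restrictScalars ℝ
  have hu := hA.unique hC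
  have e1 := DFunLike.congr_fun hu 1
  have e2 := DFunLike.congr_fun hu Complex.I
  rw [him] at e1 e2
  simp [imC] at e1 e2
  rw [← e1] at e2
  have h3 := one_le_re_latSeries_latGauss w hv
  have e3 : ((-(1 / (2 * v * √v)) : ℝ) : ℂ)
      * latSeries (fun p v => latGauss w v p) (v * Complex.I)
      + ((1 / (2 * v ^ 2) * S : ℝ) : ℂ) = 0 := by
    rw [hS]
    push_cast
    linear_combination e2
  have e4 := congrArg Complex.re e3
  rw [Complex.add_re, Complex.re_ofReal_mul, Complex.ofReal_re, Complex.zero_re, hsq] at e4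
  have e5 : (S + 1) * (latSeries (fun p v => latGauss w v p) (v * Complex.I)).re = S := by
    rw [hv_def] at e4 ⊢
    field_simp at e4
    linarith
  nlinarith

lemma exists_norm_bdrySeries_le_of_one_le_im (w : ℝ) :
    ∃ C, ∀ τ : ℂ, 1 ≤ τ.im → ‖bdrySeries w τ‖ ≤ C := by
  obtain ⟨C, k, β, hβ, h⟩ := isAdmissible_bdryTerm w 1 one_pos
  refine ⟨(∑' p, C * ((1 + latSize p) ^ k * Real.exp (-β * latSize p)))
    + 1 / 2 * (Real.exp w + Real.exp (-w)), fun τ hτ => (norm_sub_le _ _).trans (add_le_add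
      (tsum_of_norm_bounded ((summable_majorant k hβ).mul_left C).hasSum (h τ hτ)) ?_)⟩
  rw [Complex.norm_real, Real.norm_of_nonneg (by positivity)]
  gcongr
  linarith

/-! ### Comparison with the boundary functions -/

lemma tCoord_pos (z : ℍ × ℍ) : 0 < tCoord z := Real.sqrt_pos.2 (mul_pos z.1.im_pos z.2.im_pos)

lemma sCoord_pos (z : ℍ × ℍ) : 0 < sCoord z := Real.sqrt_pos.2 (div_pos z.1.im_pos z.2.im_pos)

lemma abs_add_abs_sub_abs_add (x y : ℝ) :
    |x| + |y| - |x + y| = if x * y < 0 then 2 * min |x| |y| else 0 := by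
  split_ifs with h
  · rcases mul_neg_iff.1 h with ⟨h1, h2⟩ | ⟨h1, h2⟩
    · rw [abs_of_pos h1, abs_of_neg h2]
      rcases le_total x (-y) with h3 | h3
      · rw [min_eq_left h3, abs_of_nonpos (by linarith)]; ring
      · rw [min_eq_right h3, abs_of_nonneg (by linarith)]; ring
    · rw [abs_of_neg h1, abs_of_pos h2]
      rcases le_total (-x) y with h3 | h3
      · rw [min_eq_left h3, abs_of_nonneg (by linarith)]; ring
      · rw [min_eq_right h3, abs_of_nonpos (by linarith)]; ring
  · rcases mul_nonneg_iff.1 (not_lt.1 h) with ⟨h1, h2⟩ | ⟨h1, h2⟩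
    · rw [abs_of_nonneg h1, abs_of_nonneg h2, abs_of_nonneg (add_nonneg h1 h2)]; ring
    · rw [abs_of_nonpos h1, abs_of_nonpos h2, abs_of_nonpos (add_nonpos h1 h2)]; ring

lemma boundaryXi_eq {v : ℝ} (hv : 0 < v) (z : ℍ × ℍ) (p : ℤ × ℤ) :
    boundaryXi v z p.1 p.2 = 2 * tCoord z *
      bdryTerm v (latX (Real.log (sCoord z)) p) (latY (Real.log (sCoord z)) p) := by
  have hs := sCoord_pos z
  have hq : 0 < √v := Real.sqrt_pos.2 hv
  set w := Real.log (sCoord z) with hw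
  have hx : (p.1 : ℝ) / sCoord z = latX w p := by
    rw [latX, Real.exp_neg, hw, Real.exp_log hs, div_eq_mul_inv]
  have hy : (p.2 : ℝ) * sCoord z = latY w p := by rw [latY, hw, Real.exp_log hs]
  have hB : boundaryB v (sCoord z) p.1 p.2 =
      2 * (softAbs (√v * (latX w p + latY w p)) - Real.pi * |√v * (latX w p + latY w p)|) := by
    rw [boundaryB, hx, hy, ← integral_exp_mul_rpow, mul_pow, Real.sq_sqrt hv.le, mul_assoc]
  have hI : boundaryI v (sCoord z) p.1 p.2 = 2 * Real.pi * √v *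
      (|latX w p| + |latY w p| - |latX w p + latY w p|) := by
    have hiff : 0 < -(p.1 * p.2) ↔ latX w p * latY w p < 0 := by
      rw [latX_mul_latY, neg_pos]
      exact_mod_cast Iff.rfl
    rw [boundaryI, hx, hy, abs_add_abs_sub_abs_add]
    simp only [hiff]
    split_ifs <;> ring
  rw [boundaryXi, hB, hI, bdryTerm_eq hv]
  field_simp

lemma nome_zpow (τ : ℍ) (p : ℤ × ℤ) : nome τ ^ (-(p.1 * p.2)) = qChar p τ := by
  rw [nome, ← Complex.exp_int_mul, qChar]
  push_cast
  ring_nf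

lemma nome_ne_zero (τ : ℍ) : nome τ ≠ 0 := Complex.exp_ne_zero _

/-- The terms of the double series, arranged according to the value of `-bc`. -/
lemma boundaryXi_mul_nome (z : ℍ × ℍ) (τ : ℍ) (m : ℤ) (p : pairsOf m) :
    (boundaryXi τ.im z p.1.1 p.1.2 : ℂ) * nome τ ^ m = 2 * tCoord z *
      ((bdryTerm (τ : ℂ).im (latX (Real.log (sCoord z)) p.1) (latY (Real.log (sCoord z)) p.1) : ℂ)
        * qChar p.1 τ) := by
  rw [boundaryXi_eq τ.im_pos, ← nome_zpow, show -(p.1.1 * p.1.2) = m from p.2]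
  push_cast
  rw [mul_assoc]
  rfl

lemma summable_boundaryXi (z : ℍ × ℍ) (τ : ℍ) (m : ℤ) :
    Summable fun p : pairsOf m => boundaryXi τ.im z p.1.1 p.1.2 := by
  have h := ((summable_bdryTerm (Real.log (sCoord z)) τ.im_pos).subtype (pairsOf m)).mul_left
    (2 * tCoord z : ℂ)
  have h2 := h.congr fun p => (boundaryXi_mul_nome z τ m p).symm
  exact Complex.summable_ofReal.1
    ((summable_mul_right_iff (zpow_ne_zero m (nome_ne_zero τ))).1 h2)

lemma boundaryFun_mul_nome (z : ℍ × ℍ) (τ : ℍ) (m : ℤ) :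
    (boundaryFun τ.im z m : ℂ) * nome τ ^ m = tCoord z * ∑' p : pairsOf m,
      (bdryTerm (τ : ℂ).im (latX (Real.log (sCoord z)) p.1) (latY (Real.log (sCoord z)) p.1) : ℂ)
        * qChar p.1 τ := by
  rw [boundaryFun, Complex.ofReal_mul, Complex.ofReal_tsum, mul_assoc, ← tsum_mul_right,
    tsum_congr (boundaryXi_mul_nome z τ m), tsum_mul_left]
  push_cast
  ring

lemma summable_boundaryFun_mul_nome (z : ℍ × ℍ) (τ : ℍ) :
    Summable fun m : ℤ => (boundaryFun τ.im z m : ℂ) * nome τ ^ m := by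
  have h := (Equiv.sigmaFiberEquiv fun p : ℤ × ℤ => -(p.1 * p.2)).summable_iff.2
    (summable_bdryTerm (Real.log (sCoord z)) τ.im_pos)
  exact (h.sigma.mul_left (tCoord z : ℂ)).congr fun m => (boundaryFun_mul_nome z τ m).symm

lemma boundarySeriesPlus_eq (z : ℍ × ℍ) (τ : ℍ) :
    boundarySeriesPlus z τ = tCoord z * bdrySeries (Real.log (sCoord z)) τ := by
  have hs := sCoord_pos z
  have h := (Equiv.sigmaFiberEquiv fun p : ℤ × ℤ => -(p.1 * p.2)).summable_iff.2
    (summable_bdryTerm (Real.log (sCoord z)) τ.im_pos)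
  have h1 : ∑' m : ℤ, (boundaryFun τ.im z m : ℂ) * nome τ ^ m = tCoord z *
      latSeries (fun p v => (bdryTerm v (latX (Real.log (sCoord z)) p)
        (latY (Real.log (sCoord z)) p) : ℂ)) τ := by
    rw [latSeries, ← (Equiv.sigmaFiberEquiv fun p : ℤ × ℤ => -(p.1 * p.2)).tsum_eq,
      tsum_congr (boundaryFun_mul_nome z τ), tsum_mul_left]
    exact congrArg _ h.tsum_sigma.symm
  rw [boundarySeriesPlus, h1, bdrySeries, Real.exp_neg, Real.exp_log hs, one_div (sCoord z)]
  push_cast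
  rw [show ((τ : ℂ).im : ℂ) = (τ.im : ℂ) from rfl]
  ring

lemma boundarySeriesPlus_comp_ofComplex (z : ℍ × ℍ) {τ : ℂ} (hτ : 0 < τ.im) :
    (boundarySeriesPlus z ∘ UpperHalfPlane.ofComplex) τ =
      tCoord z * bdrySeries (Real.log (sCoord z)) τ := by
  rw [Function.comp_apply, ofComplex_apply_of_im_pos hτ, boundarySeriesPlus_eq]

theorem mainTheorem7 (z : ℍ × ℍ) :
    (∀ τ : ℍ,
      (∀ m : ℤ, Summable fun p : pairsOf m => boundaryXi τ.im z p.1.1 p.1.2) ∧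
      Summable fun m : ℤ => (boundaryFun τ.im z m : ℂ) * nome τ ^ m) ∧
    IsSmoothModularForm 2 (boundarySeriesPlus z) ∧
    ¬ DifferentiableOn ℂ (boundarySeriesPlus z ∘ UpperHalfPlane.ofComplex)
      {w : ℂ | 0 < w.im} := by
  have ht : (tCoord z : ℂ) ≠ 0 := by exact_mod_cast (tCoord_pos z).ne'
  refine ⟨fun τ => ⟨summable_boundaryXi z τ, summable_boundaryFun_mul_nome z τ⟩,
    ⟨?_, fun γ => ?_, 0, ?_⟩, fun h => ?_⟩
  · exact (contDiffOn_const.mul (contDiffOn_bdrySeries _)).congr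
      fun τ hτ => boundarySeriesPlus_comp_ofComplex z hτ
  · ext τ
    have hD : denom γ τ ≠ 0 := denom_ne_zero γ τ
    rw [ModularForm.SL_slash_apply, boundarySeriesPlus_eq, boundarySeriesPlus_eq, bdrySeries_smul,
      zpow_neg]
    field_simp
  · obtain ⟨C, hC⟩ := exists_norm_bdrySeries_le_of_one_le_im (Real.log (sCoord z))
    refine Asymptotics.IsBigO.of_bound (tCoord z * C) ?_
    have h1 : ∀ᶠ τ : ℍ in atImInfty, 1 ≤ τ.im := tendsto_comap.eventually_ge_atTop 1
    filter_upwards [h1] with τ hτ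
    rw [boundarySeriesPlus_eq, norm_mul, Complex.norm_real, Real.norm_of_nonneg (tCoord_pos z).le,
      pow_zero, norm_one, mul_one]
    exact mul_le_mul_of_nonneg_left (hC τ hτ) (tCoord_pos z).le
  · refine not_differentiableOn_bdrySeries (Real.log (sCoord z))
      ((h.const_mul (tCoord z : ℂ)⁻¹).congr fun τ hτ => ?_)
    rw [boundarySeriesPlus_comp_ofComplex z hτ, inv_mul_cancel_left₀ ht]
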